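/- Let $V$ be a Euclidean Jordan algebra: a finite-dimensional real vector space with an inner product $\langle\cdot,\cdot\rangle$ and a commutative bilinear product $\circ$ with unit $u$ such that, writing $x^2=x\circ x$, one has $x^2\circ(x\circ y)=x\circ(x^2\circ y)$ and $\langle x\circ y,z\rangle=\langle x,y\circ z\rangle$ for all $x,y,z$. Write $\mathrm{tr}\,x=\langle x,u\rangle$. The positive cone of $V$ is $\mathcal Q_V=\{x^2 : x\in V\}$, and a state is an element $\rho\in\mathcal Q_V$ with $\mathrm{tr}\,\rho=1$. Every $x\in V$ has a spectral decomposition $x=\sum_i\lambda_ic_i$, where the $\lambda_i$ are distinct reals and the $c_i$ are nonzero idempotents with $c_i\circ c_j=0$ for $i\ne j$ and $\sum_ic_i=u$; it is unique up to order, and $f(x):=\sum_if(\lambda_i)c_i$ for $f:\mathbb R\to\mathbb R$. For states $\rho,\sigma$ let $c$ be the idempotent of $\sigma$ belonging to the eigenvalue $0$ ($c=0$ if $0$ is not an eigenvalue). The relative entropy is $$D(\rho\|\sigma)=\begin{cases}\mathrm{tr}\left(\rho\circ\log\rho-\rho\circ\log\sigma\right)&\text{if }\mathrm{tr}(\rho\circ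 c)=0,\\+\infty&\text{otherwise,}\end{cases}$$ with the convention $\log 0:=0$ on the eigenvalue $0$ (so that $0\log0=0$). If $\sigma$ is invertible, the first case always applies. For Euclidean Jordan algebras $V,W$, give $V\otimes W$ the bilinear product determined by $(a_1\otimes b_1)\circ(a_2\otimes b_2)=(a_1\circ a_2)\otimes(b_1\circ b_2)$. A linear map $\kappa:V\to V$ is trace preserving if $\mathrm{tr}\,\kappa(x)=\mathrm{tr}\,x$ for all $x\in V$. It is completely positive if, for every Euclidean Jordan algebra $W$ for which $V\otimes W$ with this product (and the product inner product) is again a Euclidean Jordan algebra, $\kappa\otimes\mathrm{id}_W$ maps the set of squares $\{z\circ z : z\in V\otimes W\}$ into itself. (The condition on $W$ holds, for example, for $W=\mathbb R$.) A TPCP map is a trace preserving, completely positive linear map. Theorem. Let $\rho,\sigma$ be states in $V$ and let $\kappa:V\to V$ be a TPCP map. Then $$D(\rho\|\sigma)\ \ge\ D(\kappa(\rho)\|\kappa(\sigma)),$$ as an inequality in $\mathbb R\cup\{+\infty\}$. -/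

import Mathlib

open scoped TensorProduct

noncomputable section

/-- A (unital) Euclidean Jordan algebra: a finite-dimensional real vector space with an inner
product and a commutative bilinear product `x * y` (the Jordan product `x ∘ y`) with unit `1`,
satisfying the Jordan identity (`IsCommJordan`), such that multiplication is self-adjoint for the
inner product. Associativity of the product is not assumed. -/
class EuclideanJordanAlgebra (V : Type*) [NonAssocCommRing V] [Module ℝ V] extends
    IsCommJordan V, SMulCommClass ℝ V V, IsScalarTower ℝ V V, Module.Finite ℝ V,
    toInnerCore : InnerProductSpace.Core ℝ V where
  inner_mul_assoc : ∀ x y z : V, inner (x * y) z = inner x (y * z)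

namespace EuclideanJordanAlgebra

instance instInner {V : Type*} [NonAssocCommRing V] [Module ℝ V] [EuclideanJordanAlgebra V] :
    Inner ℝ V :=
  toInnerCore.toInner

/-- The set of squares `{x ∘ x}` of an algebra; for a Euclidean Jordan algebra this is its
canonical positive cone. -/
def squareCone (A : Type*) [Mul A] : Set A := {y | ∃ x : A, y = x * x}

section

variable {V : Type*} [NonAssocCommRing V] [Module ℝ V] [EuclideanJordanAlgebra V]

/-- The trace `tr x = ⟨x, u⟩`, where `u = 1` is the unit. -/
def tr (x : V) : ℝ := inner ℝ x 1

/-- A state: an element of the positive cone with `⟨ρ, u⟩ = 1`. -/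
structure IsState (ρ : V) : Prop where
  mem_cone : ρ ∈ squareCone V
  inner_one : inner ℝ ρ (1 : V) = 1

/-- A complete system of orthogonal idempotents. -/
structure IsCSOI {n : ℕ} (c : Fin n → V) : Prop where
  orthogonal : ∀ i j, i ≠ j → c i * c j = 0
  idempotent : ∀ i, c i * c i = c i
  complete : ∑ i, c i = 1

/-- `x = ∑ i, l i • c i` is the spectral decomposition of `x`: the `l i` are distinct reals and the
`c i` are a complete system of nonzero orthogonal idempotents. -/
structure IsSpectralDecomposition {n : ℕ} (x : V) (l : Fin n → ℝ) (c : Fin n → V) : Prop where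
  csoi : IsCSOI c
  ne_zero : ∀ i, c i ≠ 0
  distinct : Function.Injective l
  eq_sum : x = ∑ i, l i • c i

/-- `y` is a value of `f` at `x`, that is `y = ∑ i, f (l i) • c i` for a spectral decomposition
`x = ∑ i, l i • c i`. -/
def IsFunctionValue (f : ℝ → ℝ) (x y : V) : Prop :=
  ∃ (n : ℕ) (l : Fin n → ℝ) (c : Fin n → V),
    IsSpectralDecomposition x l c ∧ y = ∑ i, f (l i) • c i

open Classical in
/-- The functional calculus `f(x) = ∑ i, f (l i) • c i`. By the spectral theorem every `x` has a
spectral decomposition, unique up to order, so the value `0` of the other branch is never used. -/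
def apply (f : ℝ → ℝ) (x : V) : V :=
  if h : ∃ y, IsFunctionValue f x y then h.choose else 0

/-- The logarithm of an element with nonnegative eigenvalues; on the kernel idempotent it takes
the value `0` (since `Real.log 0 = 0`). -/
def log (x : V) : V := apply Real.log x

/-- The idempotent projecting onto the kernel of `x` (zero iff `x` has no eigenvalue `0`). -/
def kernelIdempotent (x : V) : V := apply (fun t => if t = 0 then 1 else 0) x

open Classical in
/-- The relative entropy `D(ρ‖σ) = tr (ρ ∘ log ρ - ρ ∘ log σ)` of two states, with the usual
conventions for states that are not invertible: `0 log 0 = 0`, and `D(ρ‖σ) = +∞` if the support of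
`ρ` is not contained in that of `σ`, i.e. if `tr (ρ ∘ c) ≠ 0` for the kernel idempotent `c` of
`σ`. -/
def relativeEntropy (ρ σ : V) : EReal :=
  if tr (ρ * kernelIdempotent σ) = 0 then ((tr (ρ * log ρ - ρ * log σ) : ℝ) : EReal) else ⊤

end

section

variable {V₁ V₂ : Type*} [NonAssocCommRing V₁] [Module ℝ V₁] [EuclideanJordanAlgebra V₁]
  [NonAssocCommRing V₂] [Module ℝ V₂] [EuclideanJordanAlgebra V₂]

/-- A linear map is trace preserving. -/
def IsTracePreserving (κ : V₁ →ₗ[ℝ] V₂) : Prop := ∀ x, tr (κ x) = tr x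

variable (V₁ V₂) in
/-- The composite `V₁ ⊗ V₂` with the product `(a₁ ⊗ b₁) ∘ (a₂ ⊗ b₂) = (a₁ ∘ a₂) ⊗ (b₁ ∘ b₂)`
(Mathlib's multiplication on the tensor product) is a Euclidean Jordan algebra. Finite
dimensionality, unitality, commutativity, and the self-adjointness of multiplication for the
product inner product are automatic; the Jordan identity is not. -/
def CompositeIsJordan : Prop :=
  ∀ x y : V₁ ⊗[ℝ] V₂, (x * y) * (x * x) = x * (y * (x * x))

/-- Complete positivity: for every Euclidean Jordan algebra `W` such that the composites
`V₁ ⊗ W` and `V₂ ⊗ W` are Euclidean Jordan algebras, the map `κ ⊗ id` is positive, i.e. maps the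
cone of squares of `V₁ ⊗ W` into that of `V₂ ⊗ W`. As `W` is finite dimensional, it is isomorphic
to an algebra in `Type`, so restricting `W` to `Type` loses nothing. -/
def IsCompletelyPositive (κ : V₁ →ₗ[ℝ] V₂) : Prop :=
  ∀ (W : Type) [NonAssocCommRing W] [Module ℝ W] [EuclideanJordanAlgebra W],
    CompositeIsJordan V₁ W → CompositeIsJordan V₂ W →
      ∀ z ∈ squareCone (V₁ ⊗[ℝ] W), TensorProduct.map κ LinearMap.id z ∈ squareCone (V₂ ⊗[ℝ] W)

/-- A trace preserving and completely positive linear map. -/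
structure IsTPCP (κ : V₁ →ₗ[ℝ] V₂) : Prop where
  tracePreserving : IsTracePreserving κ
  completelyPositive : IsCompletelyPositive κ

end

end EuclideanJordanAlgebra

end

/-!
The proof rests on Frenkel's integral formula, for positive elements `ρ`, `σ` of equal trace,
`D(ρ‖σ) = ∫ tr (σ + u (ρ - σ))₋ / (u² |u - 1|) du` over the real line, in which both sides may be
infinite. A positive trace preserving map does not increase the trace of the negative part, hence
it does not increase the relative entropy.

The formula is the integral over `r > 0` of its analogue for the positive definite elements
`y = σ + r` and `z = ρ + r`: the number of negative eigenvalues of `y + u (z - y)` integrates to the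
Bregman divergence of `-log det`. By the law of inertia, that number is invariant under the flow
`exp (2 s L(b))` of a multiplication operator, and `log det` only changes by `2 s tr b`; choosing
the flow that takes `1` to `y` reduces the claim to `y = 1`, where the spectral decomposition of `z`
reduces it further to an integral over the real line. -/

noncomputable section

namespace EuclideanJordanAlgebra

open Polynomial Filter Topology

section Algebra

variable {V : Type*} [NonAssocCommRing V] [Module ℝ V] [EuclideanJordanAlgebra V]

instance instNormedAddCommGroup : NormedAddCommGroup V :=
  toInnerCore.toNormedAddCommGroup

instance instInnerProductSpace : InnerProductSpace ℝ V :=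
  InnerProductSpace.ofCore toInnerCore.toCore

/-- The multiplication operator `L(x) : y ↦ x ∘ y`, linear in `x`. -/
def lmul : V →ₗ[ℝ] Module.End ℝ V := LinearMap.mul ℝ V

@[simp] theorem lmul_apply (x y : V) : lmul x y = x * y := rfl

@[simp] theorem lmul_one : lmul (1 : V) = 1 := by ext; simp

theorem jordan_linearized (a b c d : V) :
    a * (b * c * d) + b * (c * a * d) + c * (a * b * d) =
      b * c * (a * d) + c * a * (b * d) + a * b * (c * d) := by
  have h := DFunLike.congr_fun (two_nsmul_lie_lmul_lmul_add_add_eq_zero a b c) d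
  change 2 • ((a * (b * c * d) - b * c * (a * d)) + (b * (c * a * d) - c * a * (b * d)) +
    (c * (a * b * d) - a * b * (c * d))) = 0 at h
  rw [← ofNat_smul_eq_nsmul ℝ] at h
  linear_combination (norm := abel) (smul_eq_zero.mp h).resolve_left two_ne_zero

theorem lmul_jordan (a b c : V) :
    lmul a * lmul (b * c) + lmul b * lmul (c * a) + lmul c * lmul (a * b) =
      lmul (b * c) * lmul a + lmul (c * a) * lmul b + lmul (a * b) * lmul c :=
  LinearMap.ext fun d => jordan_linearized a b c d

theorem lmul_mul_mul (a b c : V) :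
    lmul (a * b * c) = lmul a * lmul (b * c) + lmul b * lmul (c * a) + lmul c * lmul (a * b)
      - lmul a * lmul c * lmul b - lmul b * lmul c * lmul a := by
  ext d
  have h₁ := jordan_linearized a b c d
  have h₂ := jordan_linearized a b d c
  simp only [lmul_apply, LinearMap.add_apply, LinearMap.sub_apply, Module.End.mul_apply]
  simp only [mul_comm] at h₁ h₂ ⊢
  linear_combination (norm := abel) h₂ - h₁

theorem commute_lmul_lmul_mul_self (x : V) : Commute (lmul x) (lmul (x * x)) :=
  LinearMap.ext fun d => DFunLike.congr_fun (commute_lmul_lmul_sq x).eq d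

/-- The value `p(x)` of a real polynomial `p` at `x`, with powers of `x` taken as iterated
left multiplications. -/
def evalPoly (x : V) : ℝ[X] →ₗ[ℝ] V :=
  (LinearMap.applyₗ (1 : V)).comp (aeval (lmul x)).toLinearMap

theorem evalPoly_apply (x : V) (p : ℝ[X]) : evalPoly x p = aeval (lmul x) p 1 := rfl

@[simp] theorem evalPoly_one (x : V) : evalPoly x 1 = 1 := by simp [evalPoly_apply]

@[simp] theorem evalPoly_X (x : V) : evalPoly x X = x := by simp [evalPoly_apply]

theorem evalPoly_X_mul (x : V) (p : ℝ[X]) : evalPoly x (X * p) = x * evalPoly x p := by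
  simp [evalPoly_apply]

theorem lmul_evalPoly_X_pow_add_two (x : V) (n : ℕ) :
    lmul (evalPoly x (X ^ (n + 2))) =
      lmul x * lmul (evalPoly x (X ^ (n + 1))) + lmul (evalPoly x (X ^ n)) * lmul (x * x) +
        lmul x * lmul (evalPoly x (X ^ (n + 1))) - lmul x * lmul x * lmul (evalPoly x (X ^ n)) -
          lmul (evalPoly x (X ^ n)) * lmul x * lmul x := by
  have h₁ : evalPoly x (X ^ (n + 1)) = x * evalPoly x (X ^ n) := by
    rw [pow_succ', evalPoly_X_mul]
  have h₂ : evalPoly x (X ^ (n + 2)) = x * evalPoly x (X ^ n) * x := by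
    rw [pow_succ', evalPoly_X_mul, h₁, mul_comm]
  rw [h₂, lmul_mul_mul, mul_comm _ x, ← h₁]

theorem commute_lmul_evalPoly_X_pow (x : V) (n : ℕ) :
    Commute (lmul x) (lmul (evalPoly x (X ^ n))) := by
  induction n using Nat.twoStepInduction with
  | zero => simp
  | one => simp
  | more n h₀ h₁ =>
    have hx := Commute.refl (lmul x)
    have hx₂ := commute_lmul_lmul_mul_self x
    rw [lmul_evalPoly_X_pow_add_two]
    exact ((((hx.mul_right h₁).add_right (h₀.mul_right hx₂)).add_right (hx.mul_right h₁)).sub_right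
      ((hx.mul_right hx).mul_right h₀)).sub_right ((h₀.mul_right hx).mul_right hx)

theorem commute_lmul_evalPoly (x : V) (p : ℝ[X]) : Commute (lmul x) (lmul (evalPoly x p)) := by
  induction p using Polynomial.induction_on' with
  | add p q hp hq => simpa only [map_add] using hp.add_right hq
  | monomial n a =>
    rw [← C_mul_X_pow_eq_monomial, ← smul_eq_C_mul, map_smul, map_smul]
    exact (commute_lmul_evalPoly_X_pow x n).smul_right a

theorem evalPoly_mul (x : V) (p q : ℝ[X]) : evalPoly x (p * q) = evalPoly x p * evalPoly x q := by
  have h : Commute (aeval (lmul x) p) (lmul (evalPoly x q)) :=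
    (Algebra.commute_of_mem_adjoin_singleton_of_commute (aeval_mem_adjoin_singleton ℝ _)
      (commute_lmul_evalPoly x q).symm).symm
  calc evalPoly x (p * q) = aeval (lmul x) p (lmul (evalPoly x q) 1) := by
        rw [evalPoly_apply, map_mul, lmul_apply, mul_one, evalPoly_apply, Module.End.mul_apply]
    _ = lmul (evalPoly x q) (evalPoly x p) := DFunLike.congr_fun h.eq 1
    _ = evalPoly x p * evalPoly x q := mul_comm _ _

theorem inner_mul_left (x y z : V) : inner ℝ (x * y) z = inner ℝ x (y * z) :=
  inner_mul_assoc x y z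

theorem lmul_isSymmetric (x : V) : (lmul x).IsSymmetric := fun y z => by
  rw [lmul_apply, lmul_apply, mul_comm, inner_mul_left]

theorem tr_mul (x y : V) : tr (x * y) = inner ℝ x y := by
  rw [tr, inner_mul_left, mul_one]

theorem tr_sub (x y : V) : tr (x - y) = tr x - tr y := inner_sub_left x y 1

theorem tr_smul (a : ℝ) (x : V) : tr (a • x) = a * tr x := real_inner_smul_left x 1 a

theorem tr_sum {ι : Type*} (s : Finset ι) (x : ι → V) : tr (∑ i ∈ s, x i) = ∑ i ∈ s, tr (x i) :=
  sum_inner s x 1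

theorem continuous_tr : Continuous (tr : V → ℝ) := continuous_id.inner continuous_const

end Algebra

section SpectralTheorem

variable {V : Type*} [NonAssocCommRing V] [Module ℝ V] [EuclideanJordanAlgebra V]

theorem exists_finset_evalPoly_congr (x : V) :
    ∃ s : Finset ℝ, ∀ p q : ℝ[X], (∀ a ∈ s, p.eval a = q.eval a) → evalPoly x p = evalPoly x q := by
  have hT := lmul_isSymmetric x
  refine ⟨Finset.univ.image (hT.eigenvalues rfl), fun p q hpq => ?_⟩
  have h : aeval (lmul x) p = aeval (lmul x) q := by
    refine (hT.eigenvectorBasis rfl).toBasis.ext fun i => ?_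
    have hi := hT.hasEigenvector_eigenvectorBasis rfl i
    rw [OrthonormalBasis.coe_toBasis, Module.End.aeval_apply_of_hasEigenvector hi,
      Module.End.aeval_apply_of_hasEigenvector hi]
    congr 1
    exact hpq _ (Finset.mem_image_of_mem _ (Finset.mem_univ i))
  rw [evalPoly_apply, evalPoly_apply, h]

section LagrangeBasis

variable {x : V} {s : Finset ℝ}
  (hs : ∀ p q : ℝ[X], (∀ a ∈ s, p.eval a = q.eval a) → evalPoly x p = evalPoly x q)

include hs

theorem evalPoly_eq_sum_basis (p : ℝ[X]) :
    evalPoly x p = ∑ a ∈ s, p.eval a • evalPoly x (Lagrange.basis s id a) := by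
  have h : evalPoly x p = evalPoly x (Lagrange.interpolate s id fun a => p.eval a) :=
    hs _ _ fun a ha => (Lagrange.eval_interpolate_at_node (v := id) (fun a => p.eval a)
      Function.injective_id.injOn ha).symm
  simp only [h, Lagrange.interpolate_apply, map_sum, ← smul_eq_C_mul, map_smul]

theorem evalPoly_basis_mul_self {a : ℝ} (ha : a ∈ s) :
    evalPoly x (Lagrange.basis s id a) * evalPoly x (Lagrange.basis s id a) =
      evalPoly x (Lagrange.basis s id a) := by
  rw [← evalPoly_mul]
  refine hs _ _ fun b hb => ?_
  rcases eq_or_ne a b with rfl | hab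
  · have h : (Lagrange.basis s id a).eval a = 1 :=
      Lagrange.eval_basis_self Function.injective_id.injOn ha
    rw [eval_mul, h, mul_one]
  · have h : (Lagrange.basis s id a).eval b = 0 := Lagrange.eval_basis_of_ne (v := id) hab hb
    rw [eval_mul, h, mul_zero]

theorem evalPoly_basis_mul_of_ne {a b : ℝ} (hab : a ≠ b) :
    evalPoly x (Lagrange.basis s id a) * evalPoly x (Lagrange.basis s id b) = 0 := by
  rw [← evalPoly_mul, ← map_zero (evalPoly x)]
  refine hs _ _ fun e he => ?_
  rcases eq_or_ne a e with rfl | hae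
  · have h : (Lagrange.basis s id b).eval a = 0 := Lagrange.eval_basis_of_ne (v := id) hab.symm he
    rw [eval_mul, h, mul_zero, eval_zero]
  · have h : (Lagrange.basis s id a).eval e = 0 := Lagrange.eval_basis_of_ne (v := id) hae he
    rw [eval_mul, h, zero_mul, eval_zero]

end LagrangeBasis

theorem exists_isSpectralDecomposition (x : V) :
    ∃ (n : ℕ) (l : Fin n → ℝ) (c : Fin n → V), IsSpectralDecomposition x l c := by
  classical
  obtain ⟨s, hs⟩ := exists_finset_evalPoly_congr x
  set d : ℝ → V := fun a => evalPoly x (Lagrange.basis s id a)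
  set t := s.filter (fun a => d a ≠ 0)
  set e := t.orderEmbOfFin rfl
  have he : ∀ i, e i ∈ s ∧ d (e i) ≠ 0 := fun i =>
    Finset.mem_filter.mp (t.orderEmbOfFin_mem rfl i)
  have hsum : ∀ p : ℝ[X], evalPoly x p = ∑ i, p.eval (e i) • d (e i) := fun p =>
    calc evalPoly x p = ∑ a ∈ s, p.eval a • d a := evalPoly_eq_sum_basis hs p
      _ = ∑ a ∈ t, p.eval a • d a :=
        (Finset.sum_filter_of_ne fun _ _ h => right_ne_zero_of_smul h).symm
      _ = ∑ i, p.eval (e i) • d (e i) := by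
        conv_lhs => rw [← Finset.map_orderEmbOfFin_univ t rfl, Finset.sum_map]
        rfl
  refine ⟨t.card, e, d ∘ e, ⟨fun i j hij => ?_, fun i => ?_, ?_⟩, fun i => (he i).2,
    e.injective, ?_⟩
  · exact evalPoly_basis_mul_of_ne hs (e.injective.ne hij)
  · exact evalPoly_basis_mul_self hs (he i).1
  · simpa using (hsum 1).symm
  · simpa using hsum X

namespace IsCSOI

variable {n : ℕ} {c : Fin n → V}

omit [Module ℝ V] [EuclideanJordanAlgebra V] in
theorem mul_eq (hc : IsCSOI c) (i j : Fin n) : c i * c j = if i = j then c i else 0 := by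
  split_ifs with h
  · rw [← h, hc.idempotent]
  · exact hc.orthogonal i j h

theorem mul_sum_smul (hc : IsCSOI c) (i : Fin n) (l : Fin n → ℝ) :
    c i * ∑ j, l j • c j = l i • c i := by
  simp [Finset.mul_sum, mul_smul_comm, hc.mul_eq]

theorem sum_smul_mul_sum_smul (hc : IsCSOI c) (l m : Fin n → ℝ) :
    (∑ i, l i • c i) * ∑ i, m i • c i = ∑ i, (l i * m i) • c i := by
  simp [Finset.sum_mul, smul_mul_assoc, hc.mul_sum_smul, mul_smul]

theorem evalPoly_eq (hc : IsCSOI c) (l : Fin n → ℝ) (p : ℝ[X]) :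
    evalPoly (∑ i, l i • c i) p = ∑ i, p.eval (l i) • c i := by
  induction p using Polynomial.induction_on' with
  | add p q hp hq => simp [hp, hq, add_smul, Finset.sum_add_distrib]
  | monomial k a =>
    have h : evalPoly (∑ i, l i • c i) (X ^ k) = ∑ i, (l i ^ k) • c i := by
      induction k with
      | zero => simp [hc.complete]
      | succ k ih => simp only [pow_succ', evalPoly_X_mul, ih, hc.sum_smul_mul_sum_smul]
    rw [← C_mul_X_pow_eq_monomial, ← smul_eq_C_mul, map_smul, h, Finset.smul_sum]
    simp [mul_smul]

/-- Both sides are the value at the element of a polynomial interpolating `f`. -/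
theorem sum_apply_smul_congr {m : ℕ} {c' : Fin m → V} (hc : IsCSOI c) (hc' : IsCSOI c')
    {l : Fin n → ℝ} {l' : Fin m → ℝ} (h : ∑ i, l i • c i = ∑ i, l' i • c' i) (f : ℝ → ℝ) :
    ∑ i, f (l i) • c i = ∑ i, f (l' i) • c' i := by
  classical
  set p := Lagrange.interpolate (Finset.univ.image l ∪ Finset.univ.image l') id f
  have hp : ∀ i, p.eval (l i) = f (l i) := fun i =>
    Lagrange.eval_interpolate_at_node f Function.injective_id.injOn (by simp)
  have hp' : ∀ i, p.eval (l' i) = f (l' i) := fun i =>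
    Lagrange.eval_interpolate_at_node f Function.injective_id.injOn (by simp)
  simpa only [hc.evalPoly_eq, hc'.evalPoly_eq, hp, hp'] using congrArg (evalPoly · p) h

/-- The functional calculus may be computed from any complete system of orthogonal idempotents,
even if eigenvalues are repeated. -/
theorem apply_eq (hc : IsCSOI c) (f : ℝ → ℝ) (l : Fin n → ℝ) :
    apply f (∑ i, l i • c i) = ∑ i, f (l i) • c i := by
  have h : ∃ y, IsFunctionValue f (∑ i, l i • c i) y :=
    let ⟨m, l', c', h'⟩ := exists_isSpectralDecomposition (∑ i, l i • c i)
    ⟨_, m, l', c', h', rfl⟩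
  obtain ⟨m, l', c', h', hy⟩ := h.choose_spec
  rw [apply, dif_pos h, hy, hc.sum_apply_smul_congr h'.csoi h'.eq_sum]

end IsCSOI

theorem exists_csoi (x : V) :
    ∃ (n : ℕ) (l : Fin n → ℝ) (c : Fin n → V), IsCSOI c ∧ x = ∑ i, l i • c i :=
  let ⟨n, l, c, h⟩ := exists_isSpectralDecomposition x
  ⟨n, l, c, h.csoi, h.eq_sum⟩

end SpectralTheorem

section FunctionalCalculus

variable {V : Type*} [NonAssocCommRing V] [Module ℝ V] [EuclideanJordanAlgebra V]

theorem apply_id (x : V) : apply (fun t => t) x = x := by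
  obtain ⟨n, l, c, hc, rfl⟩ := exists_csoi x
  rw [hc.apply_eq]

theorem apply_eval (x : V) (p : ℝ[X]) : apply (fun t => p.eval t) x = evalPoly x p := by
  obtain ⟨n, l, c, hc, rfl⟩ := exists_csoi x
  rw [hc.apply_eq, hc.evalPoly_eq]

theorem apply_const (r : ℝ) (x : V) : apply (fun _ => r) x = r • (1 : V) := by
  obtain ⟨n, l, c, hc, rfl⟩ := exists_csoi x
  rw [hc.apply_eq, ← Finset.smul_sum, hc.complete]

theorem apply_sub (f g : ℝ → ℝ) (x : V) :
    apply (fun t => f t - g t) x = apply f x - apply g x := by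
  obtain ⟨n, l, c, hc, rfl⟩ := exists_csoi x
  simp only [hc.apply_eq, sub_smul, Finset.sum_sub_distrib]

theorem apply_mul (f g : ℝ → ℝ) (x : V) :
    apply (fun t => f t * g t) x = apply f x * apply g x := by
  obtain ⟨n, l, c, hc, rfl⟩ := exists_csoi x
  simp only [hc.apply_eq, hc.sum_smul_mul_sum_smul]

end FunctionalCalculus

section Positivity

variable {V : Type*} [NonAssocCommRing V] [Module ℝ V] [EuclideanJordanAlgebra V]

/-- The polynomial `2t³ - 3t² + t` annihilates `L(e)`, whose eigenvalues are thus among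
`0, 1/2, 1`. -/
theorem mul_eq_of_idempotent {e : V} (he : e * e = e) (v : V) :
    e * v = (3 : ℝ) • (e * (e * v)) - (2 : ℝ) • (e * (e * (e * v))) := by
  have h := DFunLike.congr_fun (lmul_mul_mul e e e) v
  simp only [he, lmul_apply, LinearMap.add_apply, LinearMap.sub_apply, Module.End.mul_apply] at h
  linear_combination (norm := module) h

theorem inner_mul_self_of_idempotent {e : V} (he : e * e = e) (v : V) :
    inner ℝ (e * v) v = ‖e * v‖ ^ 2 + 4 * ‖e * (e * v) - e * v‖ ^ 2 := by
  have hsymm : ∀ x y, inner ℝ (e * x) y = inner ℝ x (e * y) := lmul_isSymmetric e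
  have h : ∀ w, inner ℝ (e * v) w =
      3 * inner ℝ (e * v) (e * w) - 2 * inner ℝ (e * v) (e * (e * w)) := fun w => by
    conv_lhs => rw [mul_eq_of_idempotent he v]
    rw [inner_sub_left, real_inner_smul_left, real_inner_smul_left, hsymm (e * v) w,
      hsymm (e * (e * v)) w, hsymm (e * v) (e * w)]
  have h₁ := h v
  have h₂ := h (e * v)
  rw [← hsymm (e * v) (e * (e * v))] at h₂
  rw [norm_sub_sq_real, ← real_inner_self_eq_norm_sq, ← real_inner_self_eq_norm_sq,
    real_inner_comm (e * v) (e * (e * v))]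
  linarith

theorem inner_nonneg_of_idempotent {x e : V} (hx : x ∈ squareCone V) (he : e * e = e) :
    0 ≤ inner ℝ x e := by
  obtain ⟨v, rfl⟩ := hx
  rw [inner_mul_left, real_inner_comm, mul_comm, inner_mul_self_of_idempotent he]
  positivity

theorem tr_of_idempotent {e : V} (he : e * e = e) : tr e = ‖e‖ ^ 2 := by
  rw [← real_inner_self_eq_norm_sq, ← tr_mul, he]

theorem tr_nonneg_of_idempotent {e : V} (he : e * e = e) : 0 ≤ tr e := by
  rw [tr_of_idempotent he]; positivity

namespace IsCSOI

variable {n : ℕ} {c : Fin n → V}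

theorem tr_apply (hc : IsCSOI c) (f : ℝ → ℝ) (l : Fin n → ℝ) :
    tr (apply f (∑ i, l i • c i)) = ∑ i, f (l i) * tr (c i) := by
  simp only [hc.apply_eq, tr_sum, tr_smul]

theorem inner_sum_smul (hc : IsCSOI c) (l : Fin n → ℝ) (i : Fin n) :
    inner ℝ (∑ j, l j • c j) (c i) = l i * tr (c i) := by
  rw [← tr_mul, mul_comm, hc.mul_sum_smul, tr_smul]

theorem norm_sum_smul_le (hc : IsCSOI c) {l : Fin n → ℝ} {M : ℝ} (hM : 0 ≤ M)
    (hl : ∀ i, |l i| ≤ M) : ‖∑ i, l i • c i‖ ≤ M * ‖(1 : V)‖ := by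
  rw [← sq_le_sq₀ (by positivity) (by positivity)]
  calc ‖∑ i, l i • c i‖ ^ 2 = ∑ i, l i ^ 2 * tr (c i) := by
        rw [← real_inner_self_eq_norm_sq, ← tr_mul, hc.sum_smul_mul_sum_smul, tr_sum]
        simp only [tr_smul, sq]
    _ ≤ ∑ i, M ^ 2 * tr (c i) := by
        refine Finset.sum_le_sum fun i _ => ?_
        have hi := tr_nonneg_of_idempotent (hc.idempotent i)
        rw [← sq_abs]
        gcongr
        exact hl i
    _ = (M * ‖(1 : V)‖) ^ 2 := by
        rw [← Finset.mul_sum, ← tr_sum, hc.complete, tr_of_idempotent (mul_one 1), mul_pow]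

end IsCSOI

end Positivity

section Spectrum

variable {V : Type*} [NonAssocCommRing V] [Module ℝ V] [EuclideanJordanAlgebra V]

/-- The spectrum of `x`: the set of its eigenvalues `t`, encoded by the nonvanishing of the
spectral idempotent at `t`. -/
def spec (x : V) : Set ℝ := {t | apply (fun u => if u = t then 1 else 0) x ≠ 0}

theorem IsCSOI.spec_subset {n : ℕ} {c : Fin n → V} (hc : IsCSOI c) (l : Fin n → ℝ) :
    spec (∑ i, l i • c i) ⊆ Set.range l := fun t ht => by
  by_contra h
  have h' : ∀ i, l i ≠ t := fun i hi => h ⟨i, hi⟩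
  exact ht (by simp [hc.apply_eq, h'])

theorem IsSpectralDecomposition.spec_eq {n : ℕ} {l : Fin n → ℝ} {c : Fin n → V} {x : V}
    (h : IsSpectralDecomposition x l c) : spec x = Set.range l := by
  refine (h.eq_sum ▸ h.csoi.spec_subset l).antisymm ?_
  rintro _ ⟨i, rfl⟩
  simpa [spec, h.eq_sum, h.csoi.apply_eq, h.distinct.eq_iff] using h.ne_zero i

theorem finite_spec (x : V) : (spec x).Finite := by
  obtain ⟨n, l, c, h⟩ := exists_isSpectralDecomposition x
  exact h.spec_eq ▸ Set.finite_range l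

theorem apply_congr {f g : ℝ → ℝ} {x : V} (hfg : Set.EqOn f g (spec x)) :
    apply f x = apply g x := by
  obtain ⟨n, l, c, h⟩ := exists_isSpectralDecomposition x
  rw [h.spec_eq] at hfg
  simp only [h.eq_sum, h.csoi.apply_eq, hfg (Set.mem_range_self _)]

theorem norm_apply_le {f : ℝ → ℝ} {x : V} {M : ℝ} (hM : 0 ≤ M) (hf : ∀ t ∈ spec x, |f t| ≤ M) :
    ‖apply f x‖ ≤ M * ‖(1 : V)‖ := by
  obtain ⟨n, l, c, h⟩ := exists_isSpectralDecomposition x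
  rw [h.spec_eq, Set.forall_mem_range] at hf
  rw [h.eq_sum, h.csoi.apply_eq]
  exact h.csoi.norm_sum_smul_le hM hf

set_option maxSynthPendingDepth 3 in
theorem isBoundedBilinearMap_mul : IsBoundedBilinearMap ℝ fun p : V × V => p.1 * p.2 :=
  (LinearMap.mul ℝ V).toContinuousBilinearMap.isBoundedBilinearMap

variable (V) in
theorem exists_abs_le_norm_apply :
    ∃ C : ℝ, 0 < C ∧ ∀ x : V, ∀ t ∈ spec x, ∀ f : ℝ → ℝ, |f t| ≤ C * ‖apply f x‖ := by
  obtain ⟨C, hC, hmul⟩ := (isBoundedBilinearMap_mul (V := V)).bound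
  refine ⟨C, hC, fun x t ht f => ?_⟩
  obtain ⟨n, l, c, h⟩ := exists_isSpectralDecomposition x
  rw [h.spec_eq] at ht
  obtain ⟨i, rfl⟩ := ht
  have hi : apply f x * c i = f (l i) • c i := by
    rw [h.eq_sum, h.csoi.apply_eq, mul_comm, h.csoi.mul_sum_smul]
  have hle := hmul (apply f x) (c i)
  rw [hi, norm_smul, Real.norm_eq_abs] at hle
  exact le_of_mul_le_mul_right hle (norm_pos_iff.mpr (h.ne_zero i))

theorem mem_squareCone_iff {x : V} : x ∈ squareCone V ↔ ∀ t ∈ spec x, 0 ≤ t := by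
  obtain ⟨n, l, c, h⟩ := exists_isSpectralDecomposition x
  rw [h.spec_eq, Set.forall_mem_range]
  refine ⟨fun hx i => ?_, fun hl => ⟨∑ i, √(l i) • c i, ?_⟩⟩
  · have hpos : 0 < tr (c i) := by
      rw [tr_of_idempotent (h.csoi.idempotent i)]
      exact pow_pos (norm_pos_iff.mpr (h.ne_zero i)) 2
    have hi := inner_nonneg_of_idempotent hx (h.csoi.idempotent i)
    rw [h.eq_sum, h.csoi.inner_sum_smul] at hi
    exact nonneg_of_mul_nonneg_left hi hpos
  · simp only [h.eq_sum, h.csoi.sum_smul_mul_sum_smul, Real.mul_self_sqrt (hl _)]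

end Spectrum

section Approximation

theorem derivative_surjective : Function.Surjective (derivative : ℝ[X] →ₗ[ℝ] ℝ[X]) := fun q => by
  induction q using Polynomial.induction_on' with
  | add p q hp hq =>
    obtain ⟨p', rfl⟩ := hp
    obtain ⟨q', rfl⟩ := hq
    exact ⟨p' + q', map_add _ _ _⟩
  | monomial n a =>
    refine ⟨monomial (n + 1) (a / (n + 1)), ?_⟩
    rw [derivative_monomial, Nat.add_sub_cancel]
    push_cast
    rw [div_mul_cancel₀ _ (by positivity)]

/-- Weierstrass approximation in the `C¹` topology: approximate the derivative, and integrate. -/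
theorem exists_polynomial_near_of_contDiff {f : ℝ → ℝ} (hf : ContDiff ℝ 1 f) {M ε : ℝ}
    (hM : 0 ≤ M) (hε : 0 < ε) :
    ∃ p : ℝ[X], ∀ u, |u| ≤ M →
      |(derivative p).eval u - deriv f u| ≤ ε ∧ |p.eval u - f u| ≤ ε * M := by
  obtain ⟨q, hq⟩ := exists_polynomial_near_of_continuousOn (-M) M (deriv f)
    (hf.continuous_deriv le_rfl).continuousOn ε hε
  obtain ⟨p, rfl⟩ := derivative_surjective q
  refine ⟨p + C (f 0 - p.eval 0), fun u hu => ⟨?_, ?_⟩⟩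
  · simpa using (hq u (abs_le.mp hu)).le
  · have h := (convex_Icc (-M) M).norm_image_sub_le_of_norm_hasDerivWithin_le
      (f := fun v => p.eval v - f v) (x := 0) (y := u)
      (fun v _ => ((p.hasDerivAt v).sub
        (hf.differentiable one_ne_zero v).hasDerivAt).hasDerivWithinAt)
      (fun v hv => (hq v hv).le) ⟨by linarith, hM⟩ (abs_le.mp hu)
    calc |(p + C (f 0 - p.eval 0)).eval u - f u|
        = ‖p.eval u - f u - (p.eval 0 - f 0)‖ := by
          rw [eval_add, eval_C, Real.norm_eq_abs]; congr 1; ring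
      _ ≤ ε * ‖u - 0‖ := h
      _ ≤ ε * M := by rw [sub_zero, Real.norm_eq_abs]; gcongr

open scoped ContDiff Manifold in
/-- A function of class `C^n` on a neighbourhood of a closed set extends from a smaller
neighbourhood to the whole line, by means of a smooth cutoff. -/
theorem exists_contDiff_eventuallyEq {n : ℕ∞} {f : ℝ → ℝ} {K U : Set ℝ} (hK : IsClosed K)
    (hU : IsOpen U) (hKU : K ⊆ U) (hf : ContDiffOn ℝ n f U) :
    ∃ h : ℝ → ℝ, ContDiff ℝ n h ∧ h =ᶠ[𝓝ˢ K] f := by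
  obtain ⟨χ, hχ₀, hχ₁, -⟩ := exists_contMDiffMap_zero_one_nhds_of_isClosed (n := n) 𝓘(ℝ)
    hU.isClosed_compl hK (Set.disjoint_compl_left_iff_subset.mpr hKU)
  refine ⟨fun u => χ u * f u, contDiff_iff_contDiffAt.mpr fun u => ?_, ?_⟩
  · by_cases hu : u ∈ U
    · exact χ.contMDiff.contDiff.contDiffAt.mul (hf.contDiffAt (hU.mem_nhds hu))
    · have h₀ : (fun v => χ v * f v) =ᶠ[𝓝 u] fun _ => 0 :=
        (hχ₀.filter_mono (nhds_le_nhdsSet hu)).mono fun v hv => by simp [hv]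
      exact contDiffAt_const.congr_of_eventuallyEq h₀
  · exact hχ₁.mono fun u hu => by simp [hu]

end Approximation

section Regularity

variable {V : Type*} [NonAssocCommRing V] [Module ℝ V] [EuclideanJordanAlgebra V]

variable (V) in
theorem exists_abs_le_of_mem_spec :
    ∃ C : ℝ, 0 < C ∧ ∀ x : V, ∀ t ∈ spec x, |t| ≤ C * ‖x‖ := by
  obtain ⟨C, hC, h⟩ := exists_abs_le_norm_apply V
  exact ⟨C, hC, fun x t ht => by simpa only [apply_id] using h x t ht fun t => t⟩

theorem exists_spec_bound_of_mem_ball (x₀ : V) :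
    ∃ M : ℝ, 0 ≤ M ∧ ∀ x ∈ Metric.ball x₀ 1, ∀ t ∈ spec x, |t| ≤ M := by
  obtain ⟨C, hC, h⟩ := exists_abs_le_of_mem_spec V
  refine ⟨C * (‖x₀‖ + 1), by positivity, fun x hx t ht => (h x t ht).trans ?_⟩
  have hx' : ‖x‖ ≤ ‖x₀‖ + 1 := by
    rw [mem_ball_iff_norm] at hx
    linarith [norm_le_norm_add_norm_sub' x x₀]
  gcongr

theorem hasFDerivAt_evalPoly (x : V) (p : ℝ[X]) :
    ∃ D : V →L[ℝ] V, HasFDerivAt (fun x => evalPoly x p) D x ∧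
      ∀ (q : ℝ[X]) (v : V),
        inner ℝ (evalPoly x q) (D v) = inner ℝ (evalPoly x (q * derivative p)) v := by
  induction p using Polynomial.induction_on with
  | C a =>
    refine ⟨0, ?_, by simp⟩
    simpa only [evalPoly_apply, aeval_C] using hasFDerivAt_const _ x
  | add p q hp hq =>
    obtain ⟨D, hD, hDq⟩ := hp
    obtain ⟨E, hE, hEq⟩ := hq
    refine ⟨D + E, by simp only [map_add]; exact hD.add hE, fun r v => ?_⟩
    rw [add_apply, inner_add_right, hDq, hEq, derivative_add, mul_add, map_add,
      inner_add_left]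
  | monomial n a h =>
    obtain ⟨D, hD, hDq⟩ := h
    rw [pow_succ', mul_left_comm]
    generalize C a * X ^ n = p at hD hDq ⊢
    have hprod : HasFDerivAt (fun y => y * evalPoly y p) _ x :=
      (isBoundedBilinearMap_mul.hasFDerivAt (x, evalPoly x p)).comp
        (f := fun y => (y, evalPoly y p)) x ((hasFDerivAt_id x).prodMk hD)
    refine ⟨_, by simpa only [evalPoly_X_mul] using hprod, fun q v => ?_⟩
    change inner ℝ (evalPoly x q) (x * D v + v * evalPoly x p) = _
    have h₁ : inner ℝ (evalPoly x q) (x * D v) = inner ℝ (evalPoly x (X * q)) (D v) := by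
      rw [evalPoly_X_mul, mul_comm x (evalPoly x q), inner_mul_left]
    have h₂ : inner ℝ (evalPoly x q) (v * evalPoly x p) = inner ℝ (evalPoly x (q * p)) v := by
      rw [evalPoly_mul, inner_mul_left, mul_comm (evalPoly x p)]
    rw [inner_add_right, h₁, h₂, hDq, ← inner_add_left, ← map_add, derivative_mul, derivative_X]
    congr 2
    ring

theorem hasFDerivAt_tr_evalPoly (x : V) (p : ℝ[X]) :
    HasFDerivAt (fun x => tr (evalPoly x p)) (innerSL ℝ (evalPoly x (derivative p))) x := by
  obtain ⟨D, hD, hDq⟩ := hasFDerivAt_evalPoly x p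
  refine (((innerSL ℝ (1 : V)).hasFDerivAt.comp x hD).congr_fderiv ?_).congr_of_eventuallyEq
    (.of_forall fun x => real_inner_comm _ _)
  ext v
  simpa using hDq 1 v

theorem continuous_evalPoly (p : ℝ[X]) : Continuous fun x : V => evalPoly x p :=
  continuous_iff_continuousAt.mpr fun x =>
    let ⟨_, hD, _⟩ := hasFDerivAt_evalPoly x p
    hD.continuousAt

theorem norm_apply_sub_evalPoly_le {f : ℝ → ℝ} {p : ℝ[X]} {x : V} {ε : ℝ} (hε : 0 ≤ ε)
    (h : ∀ t ∈ spec x, |p.eval t - f t| ≤ ε) : ‖apply f x - evalPoly x p‖ ≤ ε * ‖(1 : V)‖ := by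
  rw [← apply_eval, ← apply_sub]
  exact norm_apply_le hε fun t ht => abs_sub_comm (f t) _ ▸ h t ht

theorem continuous_apply {f : ℝ → ℝ} (hf : Continuous f) :
    Continuous (apply f : V → V) := by
  refine continuous_of_locally_uniform_approx_of_continuousAt fun x₀ u hu => ?_
  obtain ⟨ε, hε, hεu⟩ := Metric.mem_uniformity_dist.mp hu
  obtain ⟨M, -, hM⟩ := exists_spec_bound_of_mem_ball x₀
  set δ := ε / (‖(1 : V)‖ + 1)
  have hδ : 0 < δ := by positivity
  obtain ⟨p, hp⟩ := exists_polynomial_near_of_continuousOn (-M) M f hf.continuousOn δ hδ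
  refine ⟨Metric.ball x₀ 1, Metric.ball_mem_nhds _ one_pos, fun x => evalPoly x p,
    (continuous_evalPoly p).continuousAt, fun x hx => hεu ?_⟩
  calc dist (apply f x) (evalPoly x p) = ‖apply f x - evalPoly x p‖ := dist_eq_norm _ _
    _ ≤ δ * ‖(1 : V)‖ := norm_apply_sub_evalPoly_le hδ.le fun t ht =>
      (hp t (abs_le.mp (hM x hx t ht))).le
    _ < δ * (‖(1 : V)‖ + 1) := by gcongr; exact lt_add_one _
    _ = ε := div_mul_cancel₀ _ (by positivity)

theorem eventually_spec_subset {x₀ : V} {U : Set ℝ} (hU : IsOpen U) (h : spec x₀ ⊆ U) :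
    ∀ᶠ x in 𝓝 x₀, spec x ⊆ U := by
  obtain ⟨C, -, hle⟩ := exists_abs_le_norm_apply V
  obtain ⟨φ, hφ₀, hφ₁, -⟩ := exists_continuous_zero_one_of_isClosed (finite_spec x₀).isClosed
    hU.isClosed_compl (Set.disjoint_compl_right_iff_subset.mpr h)
  have hx₀ : apply φ x₀ = 0 :=
    (apply_congr (g := fun _ => 0) hφ₀).trans (by rw [apply_const, zero_smul])
  have hlim : Tendsto (fun x : V => C * ‖apply φ x‖) (𝓝 x₀) (𝓝 0) := by
    have := ((continuous_apply φ.continuous).norm.const_mul C).tendsto x₀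
    rwa [hx₀, norm_zero, mul_zero] at this
  filter_upwards [hlim.eventually_lt_const one_pos] with x hx t ht
  by_contra htU
  have := hle x t ht φ
  rw [hφ₁ htU, Pi.one_apply, abs_one] at this
  linarith

theorem hasFDerivAt_tr_apply_of_contDiff {f : ℝ → ℝ} (hf : ContDiff ℝ 1 f) (x₀ : V) :
    HasFDerivAt (fun x => tr (apply f x)) (innerSL ℝ (apply (deriv f) x₀)) x₀ := by
  obtain ⟨M, hM₀, hM⟩ := exists_spec_bound_of_mem_ball x₀
  choose p hp using fun n : ℕ =>
    exists_polynomial_near_of_contDiff hf hM₀ (Nat.one_div_pos_of_nat (α := ℝ) (n := n))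
  have hlim : ∀ r : ℝ, Tendsto (fun n : ℕ => 1 / ((n : ℝ) + 1) * r) atTop (𝓝 0) := fun r => by
    simpa using tendsto_one_div_add_atTop_nhds_zero_nat.mul_const r
  refine hasFDerivAt_of_tendstoUniformlyOn (𝕜 := ℝ) (l := atTop) (s := Metric.ball x₀ 1)
    (f := fun n x => tr (evalPoly x (p n)))
    (f' := fun n x => innerSL ℝ (evalPoly x (derivative (p n))))
    (g' := fun x => innerSL ℝ (apply (deriv f) x))
    Metric.isOpen_ball ?_ (fun n x _ => hasFDerivAt_tr_evalPoly x (p n)) (fun x hx => ?_)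
    (Metric.mem_ball_self one_pos)
  · rw [Metric.tendstoUniformlyOn_iff]
    intro ε hε
    filter_upwards [(hlim ‖(1 : V)‖).eventually_lt_const hε] with n hn x hx
    rw [dist_eq_norm, ← map_sub, innerSL_apply_norm]
    exact (norm_apply_sub_evalPoly_le (by positivity)
      fun t ht => (hp n t (hM x hx t ht)).1).trans_lt hn
  · have h : Tendsto (fun n => evalPoly x (p n)) atTop (𝓝 (apply f x)) := by
      refine tendsto_iff_norm_sub_tendsto_zero.mpr
        (squeeze_zero (fun _ => norm_nonneg _) (fun n => ?_) (hlim (M * ‖(1 : V)‖)))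
      rw [norm_sub_rev, ← mul_assoc]
      exact norm_apply_sub_evalPoly_le (by positivity) fun t ht => (hp n t (hM x hx t ht)).2
    exact (continuous_tr.tendsto _).comp h

theorem hasFDerivAt_tr_apply {f : ℝ → ℝ} {U : Set ℝ} (hU : IsOpen U) (hf : ContDiffOn ℝ 1 f U)
    {x₀ : V} (hx₀ : spec x₀ ⊆ U) :
    HasFDerivAt (fun x => tr (apply f x)) (innerSL ℝ (apply (deriv f) x₀)) x₀ := by
  obtain ⟨h, hh, hhf⟩ :=
    exists_contDiff_eventuallyEq (n := 1) (finite_spec x₀).isClosed hU hx₀ hf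
  obtain ⟨W, hW, hxW, hWf⟩ := mem_nhdsSet_iff_exists.mp hhf
  have hderiv : apply (deriv h) x₀ = apply (deriv f) x₀ :=
    apply_congr fun t ht => (Filter.eventuallyEq_of_mem (hW.mem_nhds (hxW ht)) hWf).deriv_eq
  rw [← hderiv]
  refine (hasFDerivAt_tr_apply_of_contDiff hh x₀).congr_of_eventuallyEq ?_
  filter_upwards [eventually_spec_subset hW hxW] with x hx
  rw [apply_congr fun t ht => (hWf (hx ht)).symm]

end Regularity

section Quadratic

variable {V : Type*} [NonAssocCommRing V] [Module ℝ V] [EuclideanJordanAlgebra V]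

/-- The quadratic representation `P(x) = 2 L(x)² - L(x²)`, which detects invertibility:
`P(x)` is injective if and only if `0` is not an eigenvalue of `x`. -/
def quad (x : V) : Module.End ℝ V := (2 : ℝ) • (lmul x * lmul x) - lmul (x * x)

theorem quad_apply (x v : V) : quad x v = (2 : ℝ) • (x * (x * v)) - x * x * v := rfl

@[simp]
theorem quad_one : quad (1 : V) = 1 := by
  rw [quad, mul_one, lmul_one, mul_one, two_smul, add_sub_cancel_right]

/-- The infinitesimal form of the fundamental formula. -/
theorem quad_mul (b x : V) :
    (2 : ℝ) • (lmul (b * x) * lmul x + lmul x * lmul (b * x) - lmul (b * x * x)) =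
      lmul b * quad x + quad x * lmul b := by
  have h1 := lmul_mul_mul b x x
  have h2 := lmul_jordan x x b
  rw [mul_comm x b] at h1 h2
  simp only [quad, h1, mul_sub, sub_mul, smul_sub, smul_add, mul_smul_comm, smul_mul_assoc,
    mul_assoc]
  simp only [← mul_assoc] at h2 ⊢
  linear_combination (norm := module) (-1 : ℝ) • h2

theorem quad_mul_self (x : V) : quad (x * x) = quad x * quad x := by
  have h3 := lmul_mul_mul x x x
  have h4 := lmul_mul_mul x x (x * x)
  have hc := (commute_lmul_lmul_mul_self x).eq
  rw [mul_comm x (x * x), h3] at h4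
  simp only [quad, h4]
  set A := lmul x
  set B := lmul (x * x)
  have hc' : ∀ T, A * (B * T) = B * (A * T) := fun T => by rw [← mul_assoc, hc, mul_assoc]
  simp only [mul_sub, sub_mul, mul_add, smul_sub, mul_smul_comm, smul_mul_assoc, mul_assoc, hc,
    hc']
  module

theorem IsCSOI.quad_apply_self {n : ℕ} {c : Fin n → V} (hc : IsCSOI c) (l : Fin n → ℝ)
    (i : Fin n) : quad (∑ j, l j • c j) (c i) = (l i * l i) • c i := by
  rw [quad_apply, hc.sum_smul_mul_sum_smul, mul_comm _ (c i), hc.mul_sum_smul, mul_smul_comm,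
    mul_comm _ (c i), hc.mul_sum_smul, mul_comm _ (c i), hc.mul_sum_smul]
  module

theorem hasDerivAt_mul {x y : ℝ → V} {x' y' : V} {s : ℝ} (hx : HasDerivAt x x' s)
    (hy : HasDerivAt y y' s) : HasDerivAt (fun s => x s * y s) (x s * y' + x' * y s) s :=
  (isBoundedBilinearMap_mul.hasFDerivAt (x s, y s)).comp_hasDerivAt
    (l := fun p : V × V => p.1 * p.2) (f := fun s => (x s, y s)) s (hx.prodMk hy)

theorem hasDerivAt_quad {x p : ℝ → V} {x' p' : V} {s : ℝ} (hx : HasDerivAt x x' s)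
    (hp : HasDerivAt p p' s) :
    HasDerivAt (fun s => quad (x s) (p s))
      ((2 : ℝ) • (x' * (x s * p s) + x s * (x' * p s) - x' * x s * p s) + quad (x s) p') s := by
  have h1 := hasDerivAt_mul hx (hasDerivAt_mul hx hp)
  have h2 := hasDerivAt_mul (hasDerivAt_mul hx hx) hp
  refine ((h1.const_smul (2 : ℝ)).sub h2).congr_deriv ?_
  simp only [quad_apply, mul_add, add_mul, mul_comm (x s) x']
  module

end Quadratic

section Flow

section ExpFlow

variable {E : Type*} [NormedAddCommGroup E] [NormedSpace ℝ E] [FiniteDimensional ℝ E]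

/-- The one-parameter group `exp(s A)` generated by an endomorphism `A`. -/
def expFlow (A : E →ₗ[ℝ] E) (s : ℝ) : E →ₗ[ℝ] E :=
  (NormedSpace.exp (s • LinearMap.toContinuousLinearMap A) : E →L[ℝ] E).toLinearMap

theorem hasDerivAt_expFlow (A : E →ₗ[ℝ] E) (v : E) (s : ℝ) :
    HasDerivAt (fun s => expFlow A s v) (A (expFlow A s v)) s := by
  have : CompleteSpace E := FiniteDimensional.complete ℝ E
  refine ((hasDerivAt_exp_smul_const' (𝕂 := ℝ) (LinearMap.toContinuousLinearMap A) s).clm_apply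
    (hasDerivAt_const s v)).congr_deriv ?_
  rw [map_zero, add_zero]
  rfl

theorem expFlow_zero_apply (A : E →ₗ[ℝ] E) (v : E) : expFlow A 0 v = v := by
  simp [expFlow]

theorem expFlow_expFlow_neg (A : E →ₗ[ℝ] E) (v : E) (s : ℝ) :
    expFlow A s (expFlow A (-s) v) = v := by
  have : CompleteSpace E := FiniteDimensional.complete ℝ E
  set B := LinearMap.toContinuousLinearMap A
  let _ : NormedAlgebra ℚ (E →L[ℝ] E) := NormedAlgebra.restrictScalars ℚ ℝ _
  have h : NormedSpace.exp (s • B) * NormedSpace.exp ((-s) • B) = 1 := by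
    rw [← NormedSpace.exp_add_of_commute (((Commute.refl B).smul_left s).smul_right (-s)),
      ← add_smul, add_neg_cancel, zero_smul, NormedSpace.exp_zero]
  exact DFunLike.congr_fun h v

end ExpFlow

variable {V : Type*} [NonAssocCommRing V] [Module ℝ V] [EuclideanJordanAlgebra V]

/-- The one-parameter group `exp(2 s L(b))` of automorphisms of the cone. -/
def flow (b : V) (s : ℝ) : V →ₗ[ℝ] V := expFlow ((2 : ℝ) • lmul b) s

theorem hasDerivAt_flow (b v : V) (s : ℝ) :
    HasDerivAt (fun s => flow b s v) ((2 : ℝ) • (b * flow b s v)) s :=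
  hasDerivAt_expFlow ((2 : ℝ) • lmul b) v s

@[simp]
theorem flow_zero_apply (b v : V) : flow b 0 v = v := expFlow_zero_apply _ v

theorem flow_flow_neg (b v : V) (s : ℝ) : flow b s (flow b (-s) v) = v :=
  expFlow_expFlow_neg _ v s

theorem flow_neg_flow (b v : V) (s : ℝ) : flow b (-s) (flow b s v) = v := by
  simpa only [neg_neg] using flow_flow_neg b v (-s)

theorem hasDerivAt_flow_neg (b v : V) (s : ℝ) :
    HasDerivAt (fun s => flow b (-s) v) ((-2 : ℝ) • (b * flow b (-s) v)) s := by
  simpa [Function.comp_def, neg_smul] using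
    HasDerivAt.scomp s (hasDerivAt_flow b v (-s)) (hasDerivAt_neg s)

theorem inner_flow_flow_neg (b v w : V) (s : ℝ) :
    inner ℝ (flow b s v) (flow b (-s) w) = inner ℝ v w := by
  have h : ∀ s, HasDerivAt (fun s => inner ℝ (flow b s v) (flow b (-s) w)) (0 : ℝ) s := fun s => by
    refine ((hasDerivAt_flow b v s).inner ℝ (hasDerivAt_flow_neg b w s)).congr_deriv ?_
    rw [real_inner_smul_left, real_inner_smul_right, mul_comm b (flow b s v), inner_mul_left]
    ring
  simpa using is_const_of_deriv_eq_zero (fun s => (h s).differentiableAt) (fun s => (h s).deriv) s 0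

theorem inner_flow_left (b v w : V) (s : ℝ) :
    inner ℝ (flow b s v) w = inner ℝ v (flow b s w) := by
  rw [← inner_flow_flow_neg b v _ s, flow_neg_flow]

/-- The fundamental formula `P(Γ z) = Γ P(z) Γ` for the flow `Γ`. -/
theorem quad_flow (b z v : V) (s : ℝ) :
    quad (flow b s z) v = flow b s (quad z (flow b s v)) := by
  refine ext_inner_right ℝ fun w => ?_
  have h : ∀ v w s, HasDerivAt
      (fun s => inner ℝ (quad (flow b s z) (flow b (-s) v)) (flow b (-s) w)) (0 : ℝ) s := by
    intro v w s
    refine ((hasDerivAt_quad (hasDerivAt_flow b z s) (hasDerivAt_flow_neg b v s)).inner ℝ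
      (hasDerivAt_flow_neg b w s)).congr_deriv ?_
    have h1 := DFunLike.congr_fun (quad_mul b (flow b s z)) (flow b (-s) v)
    simp only [LinearMap.sub_apply, LinearMap.add_apply, LinearMap.smul_apply,
      Module.End.mul_apply, lmul_apply] at h1
    generalize flow b s z = x at *
    generalize flow b (-s) v = p at *
    generalize flow b (-s) w = q at *
    have h2 : (2 : ℝ) • ((2 : ℝ) • (b * x) * (x * p) + x * ((2 : ℝ) • (b * x) * p) -
        (2 : ℝ) • (b * x) * x * p) + quad x ((-2 : ℝ) • (b * p)) = (2 : ℝ) • (b * quad x p) := by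
      simp only [smul_mul_assoc, mul_smul_comm, map_smul]
      linear_combination (norm := module) (2 : ℝ) • h1
    rw [h2, real_inner_smul_left, real_inner_smul_right, mul_comm b (quad x p), inner_mul_left]
    ring
  have key := is_const_of_deriv_eq_zero
    (fun t => (h (flow b s v) (flow b s w) t).differentiableAt)
    (fun t => (h (flow b s v) (flow b s w) t).deriv) s 0
  simpa [flow_neg_flow, inner_flow_left] using key

theorem injective_quad_flow_iff {b z : V} {s : ℝ} :
    Function.Injective (quad (flow b s z)) ↔ Function.Injective (quad z) := by
  have hflow : Function.Bijective (flow b s) :=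
    Function.bijective_iff_has_inverse.mpr ⟨_, (flow_neg_flow b · s), (flow_flow_neg b · s)⟩
  have h : ⇑(quad (flow b s z)) = flow b s ∘ quad z ∘ flow b s :=
    funext fun v => quad_flow b z v s
  rw [h, hflow.1.of_comp_iff, Function.Injective.of_comp_iff' _ hflow]

theorem IsCSOI.flow_apply_self {n : ℕ} {c : Fin n → V} (hc : IsCSOI c) (β : Fin n → ℝ) (s : ℝ)
    (i : Fin n) : flow (∑ j, β j • c j) s (c i) = Real.exp (2 * s * β i) • c i := by
  set b := ∑ j, β j • c j with hb
  have hbc : b * c i = β i • c i := by rw [mul_comm, hb, hc.mul_sum_smul]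
  suffices h : flow b (-s) (Real.exp (2 * s * β i) • c i) = c i by
    conv_lhs => rw [← h, flow_flow_neg]
  refine ext_inner_right ℝ fun w => ?_
  have h : ∀ s, HasDerivAt (fun s => inner ℝ (Real.exp (2 * s * β i) • c i) (flow b (-s) w))
      (0 : ℝ) s := fun s => by
    have hexp : HasDerivAt (fun s => Real.exp (2 * s * β i))
        (Real.exp (2 * s * β i) * (2 * β i)) s := by
      simpa using (((hasDerivAt_id s).const_mul 2).mul_const (β i)).exp
    refine ((hexp.smul_const (c i)).inner ℝ (hasDerivAt_flow_neg b w s)).congr_deriv ?_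
    rw [real_inner_smul_left, real_inner_smul_right, ← inner_mul_left, mul_comm (c i), hbc,
      real_inner_smul_left, real_inner_smul_left]
    ring
  rw [inner_flow_left]
  simpa using is_const_of_deriv_eq_zero (fun s => (h s).differentiableAt) (fun s => (h s).deriv) s 0

theorem IsCSOI.flow_one {n : ℕ} {c : Fin n → V} (hc : IsCSOI c) (β : Fin n → ℝ) (s : ℝ) :
    flow (∑ j, β j • c j) s 1 = ∑ i, Real.exp (2 * s * β i) • c i := by
  conv_lhs => rw [← hc.complete, map_sum]
  exact Finset.sum_congr rfl fun i _ => hc.flow_apply_self β s i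

/-- Up to squaring, an element without the eigenvalue `0` is a translate of `1` by the flow. -/
theorem injective_quad_iff {x : V} : Function.Injective (quad x) ↔ 0 ∉ spec x := by
  obtain ⟨n, l, c, hx⟩ := exists_isSpectralDecomposition x
  rw [hx.spec_eq, Set.mem_range, not_exists]
  refine ⟨fun h i hi => hx.ne_zero i (h ?_), fun hl => ?_⟩
  · rw [hx.eq_sum, hx.csoi.quad_apply_self, hi, mul_zero, zero_smul, map_zero]
  · have hsq : x * x = flow (∑ i, Real.log (l i) • c i) 1 1 := by
      rw [hx.csoi.flow_one, hx.eq_sum, hx.csoi.sum_smul_mul_sum_smul]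
      refine Finset.sum_congr rfl fun i _ => ?_
      rw [mul_one, two_mul, Real.exp_add, Real.exp_log_eq_abs (hl i), abs_mul_abs_self]
    have h : Function.Injective (quad (x * x)) := by
      rw [hsq, injective_quad_flow_iff, quad_one]
      exact Function.injective_id
    rw [quad_mul_self, Module.End.coe_mul] at h
    exact Function.Injective.of_comp h

theorem zero_notMem_spec_flow_iff {b z : V} {s : ℝ} : 0 ∉ spec (flow b s z) ↔ 0 ∉ spec z := by
  rw [← injective_quad_iff, injective_quad_flow_iff, injective_quad_iff]

theorem tr_apply_flow {f : ℝ → ℝ} {k : ℝ} (hf : ContDiffOn ℝ 1 f {0}ᶜ)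
    (hk : ∀ u ≠ 0, deriv f u * u = k) (b : V) {z : V} (hz : 0 ∉ spec z) (s : ℝ) :
    tr (apply f (flow b s z)) = tr (apply f z) + s * (k * (2 * tr b)) := by
  have h : ∀ s, HasDerivAt (fun s => tr (apply f (flow b s z)) - s * (k * (2 * tr b))) 0 s := by
    intro s
    have hs : 0 ∉ spec (flow b s z) := zero_notMem_spec_flow_iff.mpr hz
    have hinner : inner ℝ (apply (deriv f) (flow b s z)) ((2 : ℝ) • (b * flow b s z)) =
        k * (2 * tr b) := by
      have hconst : apply (deriv f) (flow b s z) * flow b s z = k • 1 := by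
        rw [← apply_const k (flow b s z)]
        nth_rw 2 [← apply_id (flow b s z)]
        rw [← apply_mul]
        exact apply_congr fun u hu => hk u (ne_of_mem_of_not_mem hu hs)
      rw [real_inner_smul_right, mul_comm b, ← inner_mul_left, hconst, real_inner_smul_left,
        real_inner_comm, tr]
      ring
    have htr := (hasFDerivAt_tr_apply isOpen_compl_singleton hf
      (Set.subset_compl_singleton_iff.mpr hs)).comp_hasDerivAt s (hasDerivAt_flow b z s)
    refine (htr.sub ((hasDerivAt_id s).mul_const (k * (2 * tr b)))).congr_deriv ?_
    rw [innerSL_apply_apply, hinner]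
    ring
  have := is_const_of_deriv_eq_zero (fun s => (h s).differentiableAt) (fun s => (h s).deriv) s 0
  simp only [flow_zero_apply, zero_mul, sub_zero] at this
  linarith

/-- The indicator function of the negative half line. -/
def negIndicator (u : ℝ) : ℝ := if u < 0 then 1 else 0

/-- The trace of the negative spectral projection of `x`, counting the negative eigenvalues of
`x` with multiplicity. -/
def negIndex (x : V) : ℝ := tr (apply negIndicator x)

theorem negIndicator_eventuallyEq {u : ℝ} (hu : u ≠ 0) :
    negIndicator =ᶠ[𝓝 u] fun _ => negIndicator u := by
  rcases hu.lt_or_gt with h | h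
  · filter_upwards [Iio_mem_nhds h] with v hv
    rw [negIndicator, negIndicator, if_pos h, if_pos (Set.mem_Iio.mp hv)]
  · filter_upwards [Ioi_mem_nhds h] with v hv
    rw [negIndicator, negIndicator, if_neg h.not_gt, if_neg (not_lt.mpr (le_of_lt hv))]

/-- The law of inertia. -/
theorem negIndex_flow (b : V) {z : V} (hz : 0 ∉ spec z) (s : ℝ) :
    negIndex (flow b s z) = negIndex z := by
  have hf : ContDiffOn ℝ 1 negIndicator {0}ᶜ := fun u hu =>
    (contDiffAt_const.congr_of_eventuallyEq (negIndicator_eventuallyEq hu)).contDiffWithinAt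
  have hk : ∀ u ≠ 0, deriv negIndicator u * u = 0 := fun u hu => by
    rw [(negIndicator_eventuallyEq hu).deriv_eq, deriv_const, zero_mul]
  simpa only [negIndex, zero_mul, mul_zero, add_zero] using tr_apply_flow hf hk b hz s

/-- Determinants are multiplicative along the flow, where `tr ∘ log` is `log ∘ |det|`. -/
theorem tr_log_flow (b : V) {z : V} (hz : 0 ∉ spec z) (s : ℝ) :
    tr (log (flow b s z)) = tr (log z) + s * (2 * tr b) := by
  have hk : ∀ u ≠ 0, deriv Real.log u * u = 1 := fun u hu => by
    rw [Real.deriv_log, inv_mul_cancel₀ hu]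
  simpa only [log, one_mul] using tr_apply_flow Real.contDiffOn_log hk b hz s

theorem negIndex_eq_zero_iff {x : V} : negIndex x = 0 ↔ x ∈ squareCone V := by
  obtain ⟨n, l, c, hx⟩ := exists_isSpectralDecomposition x
  have htr : ∀ i, 0 ≤ tr (c i) := fun i => tr_nonneg_of_idempotent (hx.csoi.idempotent i)
  rw [mem_squareCone_iff, hx.spec_eq, Set.forall_mem_range, negIndex, hx.eq_sum, hx.csoi.tr_apply,
    Finset.sum_eq_zero_iff_of_nonneg fun i _ => ?_]
  · refine forall_congr' fun i => ?_
    have hne : tr (c i) ≠ 0 := by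
      rw [tr_of_idempotent (hx.csoi.idempotent i)]
      exact pow_ne_zero _ (norm_ne_zero_iff.mpr (hx.ne_zero i))
    simp [negIndicator, hne]
  · rw [negIndicator]
    split_ifs <;> simp [htr i]

end Flow

section Weight

open MeasureTheory Set

theorem lintegral_Ioi_of_hasDerivAt {g g' : ℝ → ℝ} {a l : ℝ}
    (hcont : ContinuousWithinAt g (Ici a) a) (hderiv : ∀ x ∈ Ioi a, HasDerivAt g (g' x) x)
    (hpos : ∀ x ∈ Ioi a, 0 ≤ g' x) (hg : Tendsto g atTop (𝓝 l)) :
    ∫⁻ x in Ioi a, ENNReal.ofReal (g' x) = ENNReal.ofReal (l - g a) := by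
  rw [← integral_Ioi_of_hasDerivAt_of_nonneg hcont hderiv hpos hg]
  refine (ofReal_integral_eq_lintegral_ofReal
    (integrableOn_Ioi_deriv_of_nonneg hcont hderiv hpos hg) ?_).symm
  exact (ae_restrict_iff' measurableSet_Ioi).mpr (ae_of_all _ hpos)

/-- The weight `(u² |u - 1|)⁻¹` of Frenkel's integral formula. It takes the value `0` at `u = 0`
and `u = 1`, which form a null set. -/
def weight (u : ℝ) : ℝ := (u ^ 2 * |u - 1|)⁻¹

theorem measurable_weight : Measurable weight := by unfold weight; fun_prop

/-- An antiderivative of the weight on `(1, ∞)`, and the negative of one on `(-∞, 0)`. -/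
def weightPrimitive (u : ℝ) : ℝ := Real.log (1 - u⁻¹) + u⁻¹

theorem hasDerivAt_weightPrimitive {u : ℝ} (hu : u ≠ 0) (hu1 : u ≠ 1) :
    HasDerivAt weightPrimitive (u ^ 2 * (u - 1))⁻¹ u := by
  have h1 : 1 - u⁻¹ ≠ 0 := fun h => hu1 (inv_eq_one.mp (sub_eq_zero.mp h).symm)
  have h2 := hasDerivAt_inv hu
  refine (((h2.const_sub 1).log h1).add h2).congr_deriv ?_
  have h3 : u - 1 ≠ 0 := sub_ne_zero.mpr hu1
  have h4 : 1 - u⁻¹ = (u - 1) / u := by field_simp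
  rw [h4]
  field_simp
  ring

theorem tendsto_weightPrimitive {l : Filter ℝ} (hl : Tendsto (fun u => u⁻¹) l (𝓝 0)) :
    Tendsto weightPrimitive l (𝓝 0) := by
  unfold weightPrimitive
  simpa using ((hl.const_sub 1).log (by norm_num)).add hl

theorem lintegral_Ioi_weight {a : ℝ} (ha : 1 < a) :
    ∫⁻ u in Ioi a, ENNReal.ofReal (weight u) = ENNReal.ofReal (-weightPrimitive a) := by
  have hderiv : ∀ u ∈ Ici a, HasDerivAt weightPrimitive (weight u) u := fun u hu => by
    have hu1 : 1 < u := ha.trans_le hu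
    rw [weight, abs_of_pos (sub_pos.mpr hu1)]
    exact hasDerivAt_weightPrimitive (by linarith) hu1.ne'
  rw [lintegral_Ioi_of_hasDerivAt (hderiv a self_mem_Ici).continuousAt.continuousWithinAt
    (fun u hu => hderiv u (Ioi_subset_Ici_self hu)) (fun u _ => by rw [weight]; positivity)
    (tendsto_weightPrimitive tendsto_inv_atTop_zero), zero_sub]

theorem lintegral_Iio_weight {a : ℝ} (ha : a < 0) :
    ∫⁻ u in Iio a, ENNReal.ofReal (weight u) = ENNReal.ofReal (-weightPrimitive a) := by
  have hderiv : ∀ u ∈ Ici (-a), HasDerivAt (fun u => weightPrimitive (-u)) (weight (-u)) u := by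
    intro u hu
    have hu0 : -u < 0 := by linarith [mem_Ici.mp hu]
    refine ((hasDerivAt_weightPrimitive hu0.ne (by linarith)).scomp u
      (hasDerivAt_neg u)).congr_deriv ?_
    rw [weight, abs_of_neg (by linarith), mul_neg, inv_neg, neg_one_smul]
  have hlim := (tendsto_weightPrimitive tendsto_inv_atBot_zero).comp tendsto_neg_atTop_atBot
  rw [← (Measure.measurePreserving_neg volume).setLIntegral_comp_preimage_emb
    (MeasurableEquiv.neg ℝ).measurableEmbedding, neg_preimage, neg_Iio,
    lintegral_Ioi_of_hasDerivAt (hderiv (-a) self_mem_Ici).continuousAt.continuousWithinAt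
      (fun u hu => hderiv u (Ioi_subset_Ici_self hu)) (fun u _ => by rw [weight]; positivity) hlim,
    zero_sub, neg_neg]

theorem measurable_negIndicator : Measurable negIndicator :=
  Measurable.ite measurableSet_Iio measurable_const measurable_const

theorem negIndicator_nonneg (u : ℝ) : 0 ≤ negIndicator u := by
  rw [negIndicator]; split_ifs <;> norm_num

theorem lintegral_weight_mul_negIndicator {ξ : ℝ} (hξ : 0 < 1 + ξ) :
    ∫⁻ u, ENNReal.ofReal (weight u) * ENNReal.ofReal (negIndicator (1 + u * ξ)) =
      ENNReal.ofReal (ξ - Real.log (1 + ξ)) := by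
  have hmeas : MeasurableSet {u : ℝ | 1 + u * ξ < 0} :=
    measurableSet_lt (by fun_prop) measurable_const
  have hprim : -weightPrimitive (-ξ)⁻¹ = ξ - Real.log (1 + ξ) := by
    rw [weightPrimitive, inv_inv]
    ring_nf
  calc ∫⁻ u, ENNReal.ofReal (weight u) * ENNReal.ofReal (negIndicator (1 + u * ξ))
      = ∫⁻ u in {u : ℝ | 1 + u * ξ < 0}, ENNReal.ofReal (weight u) := by
        rw [← lintegral_indicator hmeas]
        refine lintegral_congr fun u => ?_
        by_cases hu : 1 + u * ξ < 0 <;> simp [negIndicator, hu]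
    _ = ENNReal.ofReal (ξ - Real.log (1 + ξ)) := by
        rcases lt_trichotomy ξ 0 with h | rfl | h
        · have hset : {u : ℝ | 1 + u * ξ < 0} = Ioi (-ξ)⁻¹ := by
            ext u
            rw [mem_ofPred_eq, mem_Ioi, inv_lt_iff_one_lt_mul₀ (by linarith)]
            constructor <;> intro h <;> linarith
          rw [hset, lintegral_Ioi_weight ((one_lt_inv₀ (by linarith)).mpr (by linarith)), hprim]
        · simp [show ¬ (1 : ℝ) < 0 by norm_num]
        · have hset : {u : ℝ | 1 + u * ξ < 0} = Iio (-ξ)⁻¹ := by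
            ext u
            rw [mem_ofPred_eq, mem_Iio, inv_neg, lt_neg, inv_lt_iff_one_lt_mul₀ h]
            constructor <;> intro h <;> linarith
          rw [hset, lintegral_Iio_weight (inv_lt_zero.mpr (by linarith)), hprim]

end Weight

section Pencil

open MeasureTheory

variable {V : Type*} [NonAssocCommRing V] [Module ℝ V] [EuclideanJordanAlgebra V]

/-- The Bregman divergence of `-log det` from `z` to `y`; here `tr ∘ log` is `log ∘ det`. -/
def logDetDivergence (z y : V) : ℝ :=
  inner ℝ (z - y) (apply (fun t => t⁻¹) y) - tr (log z) + tr (log y)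

omit [EuclideanJordanAlgebra V] in
theorem IsCSOI.one_add_smul {n : ℕ} {c : Fin n → V} (hc : IsCSOI c) (ξ : Fin n → ℝ) (u : ℝ) :
    1 + u • ∑ k, ξ k • c k = ∑ k, (1 + u * ξ k) • c k := by
  rw [← hc.complete, Finset.smul_sum, ← Finset.sum_add_distrib]
  simp only [add_smul, one_smul, mul_smul]

theorem exists_flow_one_eq {y : V} (hy : ∀ t ∈ spec y, 0 < t) :
    ∃ b : V, flow b 1 1 = y ∧ flow b (-1) 1 = apply (fun t => t⁻¹) y ∧
      2 * tr b = tr (log y) := by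
  obtain ⟨n, m, d, h⟩ := exists_isSpectralDecomposition y
  rw [h.spec_eq, Set.forall_mem_range] at hy
  have hflow := h.csoi.flow_one fun i => Real.log (m i) / 2
  have hexp : ∀ i, Real.exp (Real.log (m i)) = m i := fun i => Real.exp_log (hy i)
  refine ⟨∑ i, (Real.log (m i) / 2) • d i, ?_, ?_, ?_⟩
  · simp only [hflow, mul_one, mul_div_cancel₀ _ (two_ne_zero' ℝ), hexp, h.eq_sum]
  · simp only [hflow, mul_neg_one, neg_mul, mul_div_cancel₀ _ (two_ne_zero' ℝ), Real.exp_neg, hexp,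
      h.eq_sum, h.csoi.apply_eq]
  · rw [log, h.eq_sum, h.csoi.tr_apply, tr_sum, Finset.mul_sum]
    refine Finset.sum_congr rfl fun i _ => ?_
    rw [tr_smul]
    ring

/-- Simultaneous diagonalization of the pencil `y + u (z - y)`: the flow taking `1` to `y` takes
the pencil `1 + u x`, for some `x`, to it. -/
theorem exists_pencil {y z : V} (hy : ∀ t ∈ spec y, 0 < t) (hz : ∀ t ∈ spec z, 0 < t) :
    ∃ (n : ℕ) (ξ w : Fin n → ℝ), (∀ k, 0 < 1 + ξ k) ∧ (∀ k, 0 ≤ w k) ∧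
      logDetDivergence z y = ∑ k, w k * (ξ k - Real.log (1 + ξ k)) ∧
      ∀ u, (∀ k, 1 + u * ξ k ≠ 0) →
        negIndex (y + u • (z - y)) = ∑ k, w k * negIndicator (1 + u * ξ k) := by
  obtain ⟨b, hb, hbinv, hblog⟩ := exists_flow_one_eq hy
  obtain ⟨n, ξ, c, h⟩ := exists_isSpectralDecomposition (flow b (-1) (z - y))
  have hflow : ∀ u : ℝ, flow b 1 (∑ k, (1 + u * ξ k) • c k) = y + u • (z - y) := fun u => by
    rw [← h.csoi.one_add_smul, ← h.eq_sum, map_add, hb, map_smul, flow_flow_neg]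
  have hz' : flow b 1 (∑ k, (1 + ξ k) • c k) = z := by simpa using hflow 1
  have hspec : spec (∑ k, (1 + ξ k) • c k) = Set.range fun k => 1 + ξ k :=
    IsSpectralDecomposition.spec_eq
      ⟨h.csoi, h.ne_zero, fun i j hij => h.distinct (add_left_cancel hij), rfl⟩
  have h0 : 0 ∉ spec (∑ k, (1 + ξ k) • c k) := by
    rw [← zero_notMem_spec_flow_iff (b := b) (s := 1), hz']
    exact fun h => (hz 0 h).false
  have hpos : ∀ k, 0 < 1 + ξ k := by
    have hmem : ∑ k, (1 + ξ k) • c k ∈ squareCone V := by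
      rw [← negIndex_eq_zero_iff, ← negIndex_flow b h0 1, hz', negIndex_eq_zero_iff,
        mem_squareCone_iff]
      exact fun t ht => (hz t ht).le
    rw [mem_squareCone_iff, hspec, Set.forall_mem_range] at hmem
    rw [hspec] at h0
    exact fun k => (hmem k).lt_of_ne fun hk => h0 ⟨k, hk.symm⟩
  refine ⟨n, ξ, fun k => tr (c k), hpos, fun k => tr_nonneg_of_idempotent (h.csoi.idempotent k),
    ?_, fun u hu => ?_⟩
  · have hlog : tr (log z) = ∑ k, Real.log (1 + ξ k) * tr (c k) + tr (log y) := by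
      rw [← hz', tr_log_flow b h0, log, h.csoi.tr_apply, one_mul, hblog]
    have hinner : inner ℝ (z - y) (apply (fun t => t⁻¹) y) = ∑ k, ξ k * tr (c k) := by
      rw [← hbinv, ← inner_flow_left, h.eq_sum, ← tr, tr_sum]
      simp only [tr_smul]
    rw [logDetDivergence, hinner, hlog, ← sub_sub, sub_add_cancel,
      ← Finset.sum_sub_distrib]
    exact Finset.sum_congr rfl fun k _ => by ring
  · have hu0 : 0 ∉ spec (∑ k, (1 + u * ξ k) • c k) := fun hmem =>
      let ⟨k, hk⟩ := h.csoi.spec_subset _ hmem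
      hu k hk
    rw [← hflow u, negIndex_flow b hu0, negIndex, h.csoi.tr_apply]
    simp only [mul_comm]

theorem ae_one_add_mul_ne_zero (ξ : ℝ) : ∀ᵐ u : ℝ, 1 + u * ξ ≠ 0 := by
  refine (volume.ae_ne (-ξ⁻¹)).mono fun u hu h => hu ?_
  have hξ : ξ ≠ 0 := fun h0 => by simp [h0] at h
  field_simp
  linarith

theorem lintegral_weight_mul_negIndex {y z : V} (hy : ∀ t ∈ spec y, 0 < t)
    (hz : ∀ t ∈ spec z, 0 < t) :
    ∫⁻ u, ENNReal.ofReal (weight u) * ENNReal.ofReal (negIndex (y + u • (z - y))) =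
      ENNReal.ofReal (logDetDivergence z y) := by
  obtain ⟨n, ξ, w, hξ, hw, hdiv, hneg⟩ := exists_pencil hy hz
  have hnonneg : ∀ k, 0 ≤ ξ k - Real.log (1 + ξ k) := fun k => by
    linarith [Real.log_le_sub_one_of_pos (hξ k)]
  have hint : ∀ᵐ u : ℝ,
      ENNReal.ofReal (weight u) * ENNReal.ofReal (negIndex (y + u • (z - y))) =
      ∑ k, ENNReal.ofReal (w k) *
        (ENNReal.ofReal (weight u) * ENNReal.ofReal (negIndicator (1 + u * ξ k))) := by
    filter_upwards [ae_all_iff.mpr fun k => ae_one_add_mul_ne_zero (ξ k)] with u hu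
    have hnonneg : ∀ k ∈ Finset.univ, 0 ≤ w k * negIndicator (1 + u * ξ k) := fun k _ =>
      mul_nonneg (hw k) (negIndicator_nonneg _)
    rw [hneg u hu, ENNReal.ofReal_sum_of_nonneg hnonneg, Finset.mul_sum]
    refine Finset.sum_congr rfl fun k _ => ?_
    rw [ENNReal.ofReal_mul (hw k), mul_left_comm]
  have hmeas : ∀ k, Measurable fun u =>
      ENNReal.ofReal (weight u) * ENNReal.ofReal (negIndicator (1 + u * ξ k)) := fun k =>
    measurable_weight.ennreal_ofReal.mul
      (measurable_negIndicator.comp (by fun_prop)).ennreal_ofReal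
  rw [lintegral_congr_ae hint, lintegral_finsetSum _ fun k _ => (hmeas k).const_mul _, hdiv,
    ENNReal.ofReal_sum_of_nonneg fun k _ => mul_nonneg (hw k) (hnonneg k)]
  refine Finset.sum_congr rfl fun k _ => ?_
  rw [lintegral_const_mul _ (hmeas k), lintegral_weight_mul_negIndicator (hξ k),
    ENNReal.ofReal_mul (hw k)]

end Pencil

section ScalarEntropy

open MeasureTheory Set

open scoped ENNReal

/-- The relative entropy `a log a - a log b - a + b` of two nonnegative numbers, with its
conventions for `a = 0` and `b = 0`. -/
def scalarEntropy (a b : ℝ) : ℝ≥0∞ :=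
  if b = 0 ∧ a ≠ 0 then ⊤ else ENNReal.ofReal (a * Real.log a - a * Real.log b - a + b)

/-- The divergence `logDetDivergence` of two positive numbers. -/
def scalarLogDivergence (a b : ℝ) : ℝ := (a - b) * b⁻¹ - Real.log a + Real.log b

theorem log_sub_log_le {a b : ℝ} (ha : 0 < a) (hb : 0 < b) :
    Real.log a - Real.log b ≤ (a - b) * b⁻¹ := by
  rw [← Real.log_div ha.ne' hb.ne', sub_mul, mul_inv_cancel₀ hb.ne', ← div_eq_mul_inv]
  exact Real.log_le_sub_one_of_pos (div_pos ha hb)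

theorem scalarLogDivergence_nonneg {a b : ℝ} (ha : 0 < a) (hb : 0 < b) :
    0 ≤ scalarLogDivergence a b := by
  rw [scalarLogDivergence]
  linarith [log_sub_log_le ha hb]

theorem mul_log_sub_mul_log_add_nonneg {a b : ℝ} (ha : 0 ≤ a) (hb : 0 ≤ b)
    (h : ¬ (b = 0 ∧ a ≠ 0)) : 0 ≤ a * Real.log a - a * Real.log b - a + b := by
  rcases ha.eq_or_lt with rfl | ha'
  · simpa using hb
  have hb' : 0 < b := hb.lt_of_ne' fun hb0 => h ⟨hb0, ha'.ne'⟩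
  have hlog := mul_le_mul_of_nonneg_left (log_sub_log_le hb' ha') ha
  have hcancel : a * ((b - a) * a⁻¹) = b - a := by field_simp
  linarith

/-- An antiderivative of `r ↦ -scalarLogDivergence (a + r) (b + r)`. -/
def scalarPotential (a b r : ℝ) : ℝ := (a + r) * (Real.log (a + r) - Real.log (b + r))

theorem hasDerivAt_scalarPotential {a b r : ℝ} (ha : 0 < a + r) (hb : 0 < b + r) :
    HasDerivAt (scalarPotential a b) (-scalarLogDivergence (a + r) (b + r)) r := by
  have hadd : ∀ a : ℝ, HasDerivAt (fun r => a + r) 1 r := fun a => (hasDerivAt_id r).const_add a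
  refine ((hadd a).mul (((hadd a).log ha.ne').sub ((hadd b).log hb.ne'))).congr_deriv ?_
  rw [scalarLogDivergence, Pi.sub_apply]
  field_simp
  ring

theorem tendsto_mul_log_one_add_div (a b : ℝ) :
    Tendsto (fun r : ℝ => (a + r) * Real.log (1 + b / r)) atTop (𝓝 b) := by
  have h₁ := Real.tendsto_mul_log_one_add_div_atTop b
  have h₂ : Tendsto (fun r : ℝ => Real.log (1 + b / r)) atTop (𝓝 (Real.log (1 + 0))) :=
    (((tendsto_const_nhds (x := b)).div_atTop tendsto_id).const_add 1).log (by norm_num)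
  simpa [add_mul] using (h₂.const_mul a).add h₁

theorem tendsto_scalarPotential {a b : ℝ} (ha : 0 ≤ a) (hb : 0 ≤ b) :
    Tendsto (scalarPotential a b) atTop (𝓝 (a - b)) := by
  have hlog : ∀ c : ℝ, 0 ≤ c → ∀ r : ℝ, 0 < r →
      Real.log (c + r) = Real.log r + Real.log (1 + c / r) := fun c hc r hr => by
    rw [← Real.log_mul hr.ne' (by positivity), mul_add, mul_one, mul_div_cancel₀ _ hr.ne', add_comm]
  refine ((tendsto_mul_log_one_add_div a a).sub (tendsto_mul_log_one_add_div a b)).congr' ?_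
  filter_upwards [eventually_gt_atTop 0] with r hr
  rw [scalarPotential, hlog a ha r hr, hlog b hb r hr]
  ring

theorem lintegral_Ioi_scalarLogDivergence {a b ε : ℝ} (ha : 0 ≤ a) (hb : 0 ≤ b) (hε : 0 ≤ ε)
    (hcont : ContinuousAt (scalarPotential a b) ε) :
    ∫⁻ r in Ioi ε, ENNReal.ofReal (scalarLogDivergence (a + r) (b + r)) =
      ENNReal.ofReal (scalarPotential a b ε - a + b) := by
  have hpos : ∀ c : ℝ, 0 ≤ c → ∀ r ∈ Ioi ε, 0 < c + r := fun c hc r hr =>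
    add_pos_of_nonneg_of_pos hc (hε.trans_lt hr)
  rw [lintegral_Ioi_of_hasDerivAt (g := fun r => -scalarPotential a b r)
    hcont.neg.continuousWithinAt
    (fun r hr => (hasDerivAt_scalarPotential (hpos a ha r hr) (hpos b hb r hr)).neg.congr_deriv
      (neg_neg _))
    (fun r hr => scalarLogDivergence_nonneg (hpos a ha r hr) (hpos b hb r hr))
    (tendsto_scalarPotential ha hb).neg]
  ring_nf

theorem continuousAt_scalarPotential_zero {a b : ℝ} (h : b = 0 → a = 0) :
    ContinuousAt (scalarPotential a b) 0 := by
  unfold scalarPotential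
  rcases eq_or_ne b 0 with rfl | hb
  · simpa [h rfl] using continuousAt_const
  · simp only [mul_sub]
    refine ContinuousAt.sub ?_ ?_
    · exact (Real.continuous_mul_log.comp (continuous_const_add a)).continuousAt
    · exact (continuous_const_add a).continuousAt.mul
        ((continuous_const_add b).continuousAt.log (by simpa using hb))

theorem tendsto_scalarPotential_zero {a : ℝ} (ha : 0 < a) :
    Tendsto (scalarPotential a 0) (𝓝[>] 0) atTop := by
  have hcont : Continuous fun r : ℝ => (a + r) * Real.log (a + r) :=
    Real.continuous_mul_log.comp (continuous_const_add a)
  have h₁ := (hcont.tendsto 0).mono_left (nhdsWithin_le_nhds (s := Set.Ioi 0))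
  have h₂ : Tendsto (fun r => a + r) (𝓝[>] 0) (𝓝 (a + 0)) :=
    ((continuous_const_add a).tendsto 0).mono_left nhdsWithin_le_nhds
  have h₃ := h₂.pos_mul_atTop (by simpa using ha) (tendsto_neg_atBot_atTop.comp
    Real.tendsto_log_nhdsGT_zero)
  refine (h₁.add_atTop h₃).congr fun r => ?_
  rw [scalarPotential, zero_add, Function.comp_apply]
  ring

theorem lintegral_scalarLogDivergence {a b : ℝ} (ha : 0 ≤ a) (hb : 0 ≤ b) :
    ∫⁻ r in Ioi 0, ENNReal.ofReal (scalarLogDivergence (a + r) (b + r)) = scalarEntropy a b := by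
  rw [scalarEntropy]
  split_ifs with h
  · obtain ⟨rfl, ha'⟩ := h
    have hpos := ha.lt_of_ne' ha'
    have hlim : Tendsto (fun ε => ENNReal.ofReal (scalarPotential a 0 ε - a + 0)) (𝓝[>] 0) (𝓝 ⊤) :=
      ENNReal.tendsto_ofReal_atTop.comp (by
        simpa [sub_eq_add_neg] using
          tendsto_atTop_add_const_right _ (-a) (tendsto_scalarPotential_zero hpos))
    refine top_unique (le_of_tendsto hlim ?_)
    filter_upwards [self_mem_nhdsWithin] with ε hε
    have hε' : 0 < ε := hε
    rw [← lintegral_Ioi_scalarLogDivergence ha le_rfl hε'.le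
      (hasDerivAt_scalarPotential (by positivity) (by positivity)).continuousAt]
    exact lintegral_mono_set (Ioi_subset_Ioi hε'.le)
  · rw [lintegral_Ioi_scalarLogDivergence ha hb le_rfl
      (continuousAt_scalarPotential_zero fun hb0 => not_not.mp fun ha0 => h ⟨hb0, ha0⟩),
      scalarPotential, add_zero, add_zero, mul_sub]

end ScalarEntropy

section NussbaumSzkola

open MeasureTheory Set

variable {V : Type*} [NonAssocCommRing V] [Module ℝ V] [EuclideanJordanAlgebra V]

theorem apply_add_smul_one (f : ℝ → ℝ) (x : V) (r : ℝ) :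
    apply f (x + r • (1 : V)) = apply (fun t => f (t + r)) x := by
  obtain ⟨n, l, c, hc, rfl⟩ := exists_csoi x
  have hshift : ∑ i, l i • c i + r • (1 : V) = ∑ i, (l i + r) • c i := by
    simp only [← hc.complete, Finset.smul_sum, ← Finset.sum_add_distrib, add_smul]
  rw [hshift, hc.apply_eq, hc.apply_eq]

theorem spec_add_smul_one_pos {x : V} (hx : x ∈ squareCone V) {r : ℝ} (hr : 0 < r) :
    ∀ t ∈ spec (x + r • (1 : V)), 0 < t := fun t ht => by
  have hmem : t - r ∈ spec x := by
    simpa only [spec, mem_ofPred_eq, apply_add_smul_one, eq_sub_iff_add_eq] using ht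
  linarith [mem_squareCone_iff.mp hx _ hmem]

/-- Nussbaum-Szkoła data of a pair of positive elements: finite families of nonnegative numbers `a`
and `b` with weights `w` (namely the eigenvalue pairs of `ρ` and `σ`, weighted by the inner products
of the eigenidempotents) that reduce expressions in `ρ` and `σ` to scalar ones. -/
structure IsNussbaumSzkola {ι : Type*} [Fintype ι] (ρ σ : V) (w a b : ι → ℝ) : Prop where
  weight_nonneg : ∀ k, 0 ≤ w k
  left_nonneg : ∀ k, 0 ≤ a k
  right_nonneg : ∀ k, 0 ≤ b k
  inner_apply : ∀ f g, inner ℝ (apply f ρ) (apply g σ) = ∑ k, w k * (f (a k) * g (b k))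

theorem exists_isNussbaumSzkola {ρ σ : V} (hρ : ρ ∈ squareCone V) (hσ : σ ∈ squareCone V) :
    ∃ (n m : ℕ) (w a b : Fin n × Fin m → ℝ), IsNussbaumSzkola ρ σ w a b := by
  obtain ⟨n, l, c, hc⟩ := exists_isSpectralDecomposition ρ
  obtain ⟨m, μ, d, hd⟩ := exists_isSpectralDecomposition σ
  rw [mem_squareCone_iff, hc.spec_eq, forall_mem_range] at hρ
  rw [mem_squareCone_iff, hd.spec_eq, forall_mem_range] at hσ
  refine ⟨n, m, fun k => inner ℝ (c k.1) (d k.2), fun k => l k.1, fun k => μ k.2,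
    fun k => inner_nonneg_of_idempotent ⟨c k.1, (hc.csoi.idempotent k.1).symm⟩
      (hd.csoi.idempotent k.2),
    fun k => hρ k.1, fun k => hσ k.2, fun f g => ?_⟩
  rw [hc.eq_sum, hd.eq_sum, hc.csoi.apply_eq, hd.csoi.apply_eq, sum_inner, Fintype.sum_prod_type]
  refine Finset.sum_congr rfl fun i _ => ?_
  rw [_root_.inner_sum]
  refine Finset.sum_congr rfl fun j _ => ?_
  rw [real_inner_smul_left, real_inner_smul_right]
  ring

namespace IsNussbaumSzkola

variable {ι : Type*} [Fintype ι] {ρ σ : V} {w a b : ι → ℝ}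

theorem tr_apply_left (h : IsNussbaumSzkola ρ σ w a b) (f : ℝ → ℝ) :
    tr (apply f ρ) = ∑ k, w k * f (a k) := by
  simpa [apply_const, tr] using h.inner_apply f fun _ => 1

theorem tr_apply_right (h : IsNussbaumSzkola ρ σ w a b) (g : ℝ → ℝ) :
    tr (apply g σ) = ∑ k, w k * g (b k) := by
  simpa [apply_const, tr, real_inner_comm] using h.inner_apply (fun _ => 1) g

theorem inner_apply_right (h : IsNussbaumSzkola ρ σ w a b) (g : ℝ → ℝ) :
    inner ℝ ρ (apply g σ) = ∑ k, w k * (a k * g (b k)) := by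
  rw [← h.inner_apply (fun t => t), apply_id]

theorem logDetDivergence_eq (h : IsNussbaumSzkola ρ σ w a b) (r : ℝ) :
    logDetDivergence (ρ + r • (1 : V)) (σ + r • (1 : V)) =
      ∑ k, w k * scalarLogDivergence (a k + r) (b k + r) := by
  have hσ : ∀ g, inner ℝ σ (apply g σ) = ∑ k, w k * (b k * g (b k)) := fun g => by
    rw [← tr_mul, ← h.tr_apply_right fun t => t * g t, apply_mul, apply_id]
  rw [logDetDivergence, add_sub_add_right_eq_sub, log, log, apply_add_smul_one,
    apply_add_smul_one, apply_add_smul_one, inner_sub_left, h.inner_apply_right, hσ,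
    h.tr_apply_left, h.tr_apply_right, ← Finset.sum_sub_distrib, ← Finset.sum_sub_distrib,
    ← Finset.sum_add_distrib]
  refine Finset.sum_congr rfl fun k _ => ?_
  rw [scalarLogDivergence]
  ring

theorem lintegral_logDetDivergence (h : IsNussbaumSzkola ρ σ w a b) :
    ∫⁻ r in Ioi (0 : ℝ),
      ENNReal.ofReal (logDetDivergence (ρ + r • (1 : V)) (σ + r • (1 : V))) =
      ∑ k, ENNReal.ofReal (w k) * scalarEntropy (a k) (b k) := by
  have hmeas : ∀ k, Measurable fun r =>
      ENNReal.ofReal (scalarLogDivergence (a k + r) (b k + r)) := fun k => by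
    unfold scalarLogDivergence
    fun_prop
  have hsum : ∀ r ∈ Ioi (0 : ℝ),
      ENNReal.ofReal (logDetDivergence (ρ + r • (1 : V)) (σ + r • (1 : V))) =
      ∑ k, ENNReal.ofReal (w k) * ENNReal.ofReal (scalarLogDivergence (a k + r) (b k + r)) := by
    intro r hr
    have hpos : ∀ k ∈ Finset.univ, 0 ≤ w k * scalarLogDivergence (a k + r) (b k + r) := fun k _ =>
      mul_nonneg (h.weight_nonneg k) (scalarLogDivergence_nonneg
        (add_pos_of_nonneg_of_pos (h.left_nonneg k) hr)
        (add_pos_of_nonneg_of_pos (h.right_nonneg k) hr))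
    rw [h.logDetDivergence_eq, ENNReal.ofReal_sum_of_nonneg hpos]
    exact Finset.sum_congr rfl fun k _ => ENNReal.ofReal_mul (h.weight_nonneg k)
  rw [setLIntegral_congr_fun measurableSet_Ioi hsum,
    lintegral_finsetSum _ fun k _ => (hmeas k).const_mul _]
  refine Finset.sum_congr rfl fun k _ => ?_
  rw [lintegral_const_mul _ (hmeas k),
    lintegral_scalarLogDivergence (h.left_nonneg k) (h.right_nonneg k)]

theorem tr_mul_kernelIdempotent_eq_zero_iff (h : IsNussbaumSzkola ρ σ w a b) :
    tr (ρ * kernelIdempotent σ) = 0 ↔ ∀ k, w k = 0 ∨ ¬ (b k = 0 ∧ a k ≠ 0) := by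
  rw [tr_mul, kernelIdempotent, h.inner_apply_right, Finset.sum_eq_zero_iff_of_nonneg fun k _ =>
    mul_nonneg (h.weight_nonneg k) (mul_nonneg (h.left_nonneg k) (by split_ifs <;> norm_num))]
  simp [imp_iff_not_or, or_left_comm, or_comm]

theorem tr_mul_log_sub (h : IsNussbaumSzkola ρ σ w a b) (htr : tr ρ = tr σ) :
    tr (ρ * log ρ - ρ * log σ) =
      ∑ k, w k * (a k * Real.log (a k) - a k * Real.log (b k) - a k + b k) := by
  have hρ : tr (ρ * log ρ) = ∑ k, w k * (a k * Real.log (a k)) := by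
    rw [← h.tr_apply_left fun t => t * Real.log t, apply_mul, apply_id, log]
  have htr' : ∑ k, w k * a k = ∑ k, w k * b k := by
    rw [← h.tr_apply_left fun t => t, ← h.tr_apply_right fun t => t, apply_id, apply_id, htr]
  simp only [mul_add, mul_sub, Finset.sum_add_distrib, Finset.sum_sub_distrib, htr',
    sub_add_cancel]
  rw [tr_sub, hρ, tr_mul, log, h.inner_apply_right]

theorem relativeEntropy_eq (h : IsNussbaumSzkola ρ σ w a b) (htr : tr ρ = tr σ) :
    relativeEntropy ρ σ =
      ((∑ k, ENNReal.ofReal (w k) * scalarEntropy (a k) (b k) : ENNReal) : EReal) := by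
  rw [relativeEntropy]
  split_ifs with hsupp <;> rw [h.tr_mul_kernelIdempotent_eq_zero_iff] at hsupp
  · have hterm : ∀ k, ENNReal.ofReal (w k) * scalarEntropy (a k) (b k) = ENNReal.ofReal
        (w k * (a k * Real.log (a k) - a k * Real.log (b k) - a k + b k)) := fun k => by
      rw [ENNReal.ofReal_mul (h.weight_nonneg k)]
      rcases hsupp k with hk | hk
      · simp only [hk, ENNReal.ofReal_zero, zero_mul]
      · rw [scalarEntropy, if_neg hk]
    have hnonneg : ∀ k ∈ Finset.univ,
        0 ≤ w k * (a k * Real.log (a k) - a k * Real.log (b k) - a k + b k) := fun k _ => by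
      rcases hsupp k with hk | hk
      · rw [hk, zero_mul]
      · exact mul_nonneg (h.weight_nonneg k)
          (mul_log_sub_mul_log_add_nonneg (h.left_nonneg k) (h.right_nonneg k) hk)
    rw [Finset.sum_congr rfl fun k _ => hterm k, ← ENNReal.ofReal_sum_of_nonneg hnonneg,
      ← h.tr_mul_log_sub htr, EReal.coe_ennreal_ofReal, max_eq_left]
    rw [h.tr_mul_log_sub htr]
    exact Finset.sum_nonneg hnonneg
  · push Not at hsupp
    obtain ⟨k, hwk, hk⟩ := hsupp
    have htop : ENNReal.ofReal (w k) * scalarEntropy (a k) (b k) = ⊤ := by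
      rw [scalarEntropy, if_pos hk]
      exact ENNReal.mul_top (ENNReal.ofReal_pos.mpr ((h.weight_nonneg k).lt_of_ne' hwk)).ne'
    rw [ENNReal.sum_eq_top.mpr ⟨k, Finset.mem_univ k, htop⟩, EReal.coe_ennreal_top]

end IsNussbaumSzkola

end NussbaumSzkola

section Measurability

variable {V : Type*} [NonAssocCommRing V] [Module ℝ V] [EuclideanJordanAlgebra V]

/-- Continuous functions converging pointwise to the indicator of the negative half line. -/
def negRamp (k : ℕ) (t : ℝ) : ℝ := min 1 (max 0 (-(k * t)))

theorem continuous_negRamp (k : ℕ) : Continuous (negRamp k) := by unfold negRamp; fun_prop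

theorem tendsto_negRamp (t : ℝ) : Tendsto (fun k => negRamp k t) atTop (𝓝 (negIndicator t)) := by
  refine tendsto_const_nhds.congr' ?_
  unfold negRamp negIndicator
  split_ifs with ht
  · obtain ⟨n, hn⟩ := exists_nat_ge (-t)⁻¹
    filter_upwards [eventually_ge_atTop n] with k hk
    have hkt : (-t)⁻¹ ≤ k := hn.trans (by exact_mod_cast hk)
    rw [inv_le_iff_one_le_mul₀ (by linarith)] at hkt
    rw [max_eq_right (by linarith), min_eq_left (by linarith)]
  · filter_upwards with k
    have hkt : 0 ≤ (k : ℝ) * t := mul_nonneg k.cast_nonneg (not_lt.mp ht)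
    rw [max_eq_left (by linarith), min_eq_right zero_le_one]

theorem measurable_negIndex_comp {X : Type*} [TopologicalSpace X] [MeasurableSpace X]
    [OpensMeasurableSpace X] {x : X → V} (hx : Continuous x) :
    Measurable fun p => negIndex (x p) := by
  refine measurable_of_tendsto_metrizable (f := fun k p => tr (apply (negRamp k) (x p)))
    (fun k => (continuous_tr.comp ((continuous_apply (continuous_negRamp k)).comp hx)).measurable)
    (tendsto_pi_nhds.mpr fun p => ?_)
  obtain ⟨n, l, c, hc, h⟩ := exists_csoi (x p)
  simp only [negIndex, h, hc.tr_apply]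
  exact tendsto_finsetSum _ fun i _ => (tendsto_negRamp _).mul_const _

end Measurability

section FrenkelFormula

open MeasureTheory Set

variable {V : Type*} [NonAssocCommRing V] [Module ℝ V] [EuclideanJordanAlgebra V]

/-- The trace of the negative part. -/
def trNeg (x : V) : ℝ := tr (apply (fun t => max (-t) 0) x)

theorem lintegral_negIndicator_add (a : ℝ) :
    ∫⁻ r in Ioi (0 : ℝ), ENNReal.ofReal (negIndicator (a + r)) = ENNReal.ofReal (max (-a) 0) := by
  have hind : ∀ r, ENNReal.ofReal (negIndicator (a + r)) = (Iio (-a)).indicator 1 r := fun r => by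
    by_cases hr : a + r < 0 <;> simp [negIndicator, indicator, hr, lt_neg_iff_add_neg']
  simp_rw [hind]
  rw [lintegral_indicator_one measurableSet_Iio, Measure.restrict_apply measurableSet_Iio,
    Iio_inter_Ioi, Real.volume_Ioo, sub_zero, ENNReal.ofReal_max, ENNReal.ofReal_zero,
    max_eq_left zero_le]

theorem lintegral_negIndex_add_smul_one (x : V) :
    ∫⁻ r in Ioi (0 : ℝ), ENNReal.ofReal (negIndex (x + r • (1 : V))) =
      ENNReal.ofReal (trNeg x) := by
  obtain ⟨n, l, c, hc, rfl⟩ := exists_csoi x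
  have htr : ∀ i, 0 ≤ tr (c i) := fun i => tr_nonneg_of_idempotent (hc.idempotent i)
  have hsum : ∀ f : ℝ → ℝ, (∀ t, 0 ≤ f t) → ENNReal.ofReal (tr (apply f (∑ i, l i • c i))) =
      ∑ i, ENNReal.ofReal (f (l i)) * ENNReal.ofReal (tr (c i)) := fun f hf => by
    rw [hc.tr_apply, ENNReal.ofReal_sum_of_nonneg fun i _ => mul_nonneg (hf _) (htr i)]
    exact Finset.sum_congr rfl fun i _ => ENNReal.ofReal_mul (hf _)
  have hmeas : ∀ i, Measurable fun r => ENNReal.ofReal (negIndicator (l i + r)) := fun i =>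
    (measurable_negIndicator.comp (measurable_const_add _)).ennreal_ofReal
  simp only [negIndex, apply_add_smul_one, hsum _ fun _ => negIndicator_nonneg _]
  rw [trNeg, hsum _ fun _ => le_max_right _ _,
    lintegral_finsetSum _ fun i _ => (hmeas i).mul_const _]
  refine Finset.sum_congr rfl fun i _ => ?_
  rw [lintegral_mul_const _ (hmeas i), lintegral_negIndicator_add]

/-- **Frenkel's integral formula** for the relative entropy. -/
theorem relativeEntropy_eq_lintegral {ρ σ : V} (hρ : ρ ∈ squareCone V) (hσ : σ ∈ squareCone V)
    (htr : tr ρ = tr σ) :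
    relativeEntropy ρ σ = ((∫⁻ u, ENNReal.ofReal (weight u) *
      ENNReal.ofReal (trNeg (σ + u • (ρ - σ))) : ENNReal) : EReal) := by
  obtain ⟨n, m, w, a, b, h⟩ := exists_isNussbaumSzkola hρ hσ
  rw [h.relativeEntropy_eq htr, ← h.lintegral_logDetDivergence]
  congr 1
  have hinner : ∀ r ∈ Ioi (0 : ℝ),
      ENNReal.ofReal (logDetDivergence (ρ + r • (1 : V)) (σ + r • (1 : V))) =
      ∫⁻ u, ENNReal.ofReal (weight u) *
        ENNReal.ofReal (negIndex (σ + u • (ρ - σ) + r • (1 : V))) := fun r hr => by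
    rw [← lintegral_weight_mul_negIndex (spec_add_smul_one_pos hσ hr) (spec_add_smul_one_pos hρ hr)]
    simp only [add_sub_add_right_eq_sub, add_right_comm]
  have hmeas : Measurable fun p : ℝ × ℝ => ENNReal.ofReal (weight p.2) *
      ENNReal.ofReal (negIndex (σ + p.2 • (ρ - σ) + p.1 • (1 : V))) :=
    (measurable_weight.comp measurable_snd).ennreal_ofReal.mul
      (measurable_negIndex_comp (by fun_prop)).ennreal_ofReal
  rw [setLIntegral_congr_fun measurableSet_Ioi hinner, lintegral_lintegral_swap hmeas.aemeasurable]
  refine lintegral_congr fun u => ?_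
  rw [lintegral_const_mul _ (measurable_negIndex_comp (by fun_prop)).ennreal_ofReal,
    lintegral_negIndex_add_smul_one]

end FrenkelFormula

section Monotonicity

variable {V W : Type*} [NonAssocCommRing V] [Module ℝ V] [EuclideanJordanAlgebra V]
  [NonAssocCommRing W] [Module ℝ W] [EuclideanJordanAlgebra W]

theorem apply_mem_squareCone {f : ℝ → ℝ} (hf : ∀ t, 0 ≤ f t) (x : V) :
    apply f x ∈ squareCone V := by
  refine ⟨apply (fun t => √(f t)) x, ?_⟩
  simp only [← apply_mul, Real.mul_self_sqrt (hf _)]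

theorem inner_apply_negIndicator (x : V) : inner ℝ x (apply negIndicator x) = -trNeg x := by
  obtain ⟨n, l, c, hc, rfl⟩ := exists_csoi x
  rw [trNeg, ← tr_mul]
  nth_rw 1 [← apply_id (∑ i, l i • c i)]
  rw [← apply_mul, hc.tr_apply, hc.tr_apply, ← Finset.sum_neg_distrib]
  refine Finset.sum_congr rfl fun i _ => ?_
  rw [negIndicator]
  split_ifs with hi
  · rw [max_eq_left (by linarith)]; ring
  · rw [max_eq_right (by linarith)]; ring

theorem trNeg_sub_le {p q : V} (hp : p ∈ squareCone V) (hq : q ∈ squareCone V) :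
    trNeg (p - q) ≤ tr q := by
  set e := apply negIndicator (p - q) with he_def
  have he : e * e = e := by
    rw [he_def, ← apply_mul]
    congr 1
    ext t
    rw [negIndicator]
    split_ifs <;> norm_num
  have he' : (1 - e) * (1 - e) = 1 - e := by
    rw [mul_sub, mul_one, sub_mul, he, one_mul, sub_self, sub_zero]
  have hpe := inner_nonneg_of_idempotent hp he
  have hqe := inner_nonneg_of_idempotent hq he'
  have hneg := inner_apply_negIndicator (p - q)
  rw [← he_def, inner_sub_left] at hneg
  rw [inner_sub_right] at hqe
  rw [tr]
  linarith

theorem trNeg_map_le {κ : V →ₗ[ℝ] W} (hpos : ∀ x ∈ squareCone V, κ x ∈ squareCone W)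
    (htr : IsTracePreserving κ) (x : V) : trNeg (κ x) ≤ trNeg x := by
  have hsub : apply (fun t => max t 0) x - apply (fun t => max (-t) 0) x = x := by
    simp only [← apply_sub, max_zero_sub_max_neg_zero_eq_self, apply_id]
  have hmem : ∀ f : ℝ → ℝ, (∀ t, 0 ≤ f t) → κ (apply f x) ∈ squareCone W := fun f hf =>
    hpos _ (apply_mem_squareCone hf x)
  calc trNeg (κ x)
      = trNeg (κ (apply (fun t => max t 0) x) - κ (apply (fun t => max (-t) 0) x)) := by
        rw [← map_sub, hsub]
    _ ≤ tr (κ (apply (fun t => max (-t) 0) x)) :=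
        trNeg_sub_le (hmem _ fun _ => le_max_right _ _) (hmem _ fun _ => le_max_right _ _)
    _ = trNeg x := htr _

end Monotonicity

section CompletePositivity

/-- The real numbers as a Euclidean Jordan algebra, the trivial ancilla. -/
abbrev realEuclideanJordanAlgebra : EuclideanJordanAlgebra ℝ where
  inner x y := x * y
  conj_inner_symm x y := by simp [mul_comm]
  re_inner_nonneg x := by simpa using mul_self_nonneg x
  add_left x y z := add_mul x y z
  smul_left x y r := by simp [mul_assoc]
  definite x hx := mul_self_eq_zero.mp hx
  inner_mul_assoc x y z := mul_assoc x y z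

variable {V W : Type*} [NonAssocCommRing V] [Module ℝ V] [EuclideanJordanAlgebra V]
  [NonAssocCommRing W] [Module ℝ W] [EuclideanJordanAlgebra W]

omit [EuclideanJordanAlgebra V] in
theorem exists_eq_tmul_one (z : V ⊗[ℝ] ℝ) : ∃ v : V, z = v ⊗ₜ[ℝ] (1 : ℝ) :=
  ⟨TensorProduct.rid ℝ V z, by rw [← TensorProduct.rid_symm_apply, LinearEquiv.symm_apply_apply]⟩

variable (V) in
theorem compositeIsJordan_real :
    @CompositeIsJordan V ℝ _ _ _ _ _ realEuclideanJordanAlgebra := by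
  intro a b
  obtain ⟨x, rfl⟩ := exists_eq_tmul_one a
  obtain ⟨y, rfl⟩ := exists_eq_tmul_one b
  simp only [Algebra.TensorProduct.tmul_mul_tmul, mul_one, IsCommJordan.lmul_comm_rmul_rmul]

theorem IsCompletelyPositive.map_mem_squareCone {κ : V →ₗ[ℝ] W} (hκ : IsCompletelyPositive κ) :
    ∀ x ∈ squareCone V, κ x ∈ squareCone W := by
  rintro _ ⟨x, rfl⟩
  obtain ⟨z, hz⟩ := @hκ ℝ _ _ realEuclideanJordanAlgebra (compositeIsJordan_real V)
    (compositeIsJordan_real W) ((x * x) ⊗ₜ[ℝ] (1 : ℝ))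
    ⟨x ⊗ₜ[ℝ] (1 : ℝ), by rw [Algebra.TensorProduct.tmul_mul_tmul, mul_one]⟩
  obtain ⟨y, rfl⟩ := exists_eq_tmul_one z
  refine ⟨y, ?_⟩
  simpa using congrArg (TensorProduct.rid ℝ W) hz

end CompletePositivity

end EuclideanJordanAlgebra

end

open EuclideanJordanAlgebra in
theorem theorem4p3_general {V W : Type*} [NonAssocCommRing V] [Module ℝ V]
    [EuclideanJordanAlgebra V] [NonAssocCommRing W] [Module ℝ W] [EuclideanJordanAlgebra W]
    {ρ σ : V} (hρ : ρ ∈ squareCone V) (hσ : σ ∈ squareCone V) (h : tr ρ = tr σ)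
    {κ : V →ₗ[ℝ] W} (hpos : ∀ x ∈ squareCone V, κ x ∈ squareCone W) (htr : IsTracePreserving κ) :
    relativeEntropy (κ ρ) (κ σ) ≤ relativeEntropy ρ σ := by
  rw [relativeEntropy_eq_lintegral hρ hσ h,
    relativeEntropy_eq_lintegral (hpos ρ hρ) (hpos σ hσ) ((htr ρ).trans (h.trans (htr σ).symm)),
    EReal.coe_ennreal_le_coe_ennreal_iff]
  refine MeasureTheory.lintegral_mono fun u => mul_le_mul_right (ENNReal.ofReal_le_ofReal ?_) _
  simpa only [map_add, map_smul, map_sub] using trNeg_map_le hpos htr (σ + u • (ρ - σ))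

theorem theorem4p3 {V : Type*} [NonAssocCommRing V] [Module ℝ V] [EuclideanJordanAlgebra V]
    (ρ σ : V) (hρ : EuclideanJordanAlgebra.IsState ρ) (hσ : EuclideanJordanAlgebra.IsState σ)
    (κ : V →ₗ[ℝ] V) (hκ : EuclideanJordanAlgebra.IsTPCP κ) :
    EuclideanJordanAlgebra.relativeEntropy (κ ρ) (κ σ) ≤
      EuclideanJordanAlgebra.relativeEntropy ρ σ :=
  theorem4p3_general hρ.mem_cone hσ.mem_cone (hρ.inner_one.trans hσ.inner_one.symm)
    hκ.completelyPositive.map_mem_squareCone hκ.tracePreserving
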